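/- **Model.** A *black-box program* for $n\times n$ matrices is an algebraic computation tree. Its instructions store the constants $0$, $1$, add, subtract, multiply or divide stored field elements, test a stored element for zero and branch on the outcome, draw an element uniformly and independently from a finite non-empty set $S\subseteq K$, and call the black box, i.e. replace a stored vector $v\in K^n$ by the product of the matrix with $v$. The program has no other access to the matrix, and it is the same over all fields $K$. Each instruction counts as one field operation, except a call of the black box, which counts as $\Omega$ field operations, where $\Omega\ge n$. **Algorithm (Nullity).** Input: a matrix $A\in K^{n\times n}$ over a field $K$, given as a black box; the coefficients of an irreducible factor $P$ of the minimal polynomial $P^A_{\min}$ of $A$; its degree $d=\deg P$; its multiplicity $e$ in $P^A_{\min}$. Compute $r=\operatorname{rank}(P^e(A))$ by running a black-box rank program on the black box $v\mapsto P^e(A)v$, which applies $e$ times Horner's rule $P(A)v=a_0v+A(a_1v+A(a_2v+\dots+A(a_dv)))$. Return $(n-r)/d$ (rounded down, and $0$ if $r>n$). **Proposition.** There are a constant $C$ and black-box rank programs, one for each $n$, such that the following holds for all fields $K$, all finite non-empty sets $S\subseteq K$, all $n$, all $A\in K^{n\times n}$, all irreducible factors $P$ of $P^A_{\min}$, of degree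 $d$ and of multiplicity $e$ in $P^A_{\min}$ and multiplicity $m$ in the characteristic polynomial of $A$, and all $\Omega\ge n$: 1. $(n-\operatorname{rank}P^e(A))/d=m$. 2. The Horner black box correctly computes $P^e(A)v$ for each $v\in K^n$, with exactly $ed$ calls of the black box for $A$, and at most $C\,e\,d\,\Omega$ field operations in total. 3. The rank step of the Nullity algorithm returns $\operatorname{rank}P^e(A)$, except with probability at most $Cn^2/|S|$. 4. The Nullity algorithm returns the multiplicity $m$ of $P$ in the characteristic polynomial of $A$, except with probability at most $Cn^2/|S|$. (Over a finite field one may take $S=K$, so the algorithm is reliable over every large enough field.) 5. For all outcomes of the random choices, the Nullity algorithm uses at most $C\,e\,d\,n\,\Omega$ field operations. -/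

import Mathlib

/-!
Randomised black-box algorithms over a field, with a count of field operations.

A program is an algebraic computation tree. Field elements are never visible to the control flow:
the program only holds addresses (natural numbers) of memory cells, every instruction stores its
result in fresh cells, and the only information on field elements that may influence the control
flow is the outcome of a zero test. The tree contains no field: one program runs over all fields.
-/

namespace BlackBox

/-- The arithmetic operations of a field. -/
inductive ArithOp : Type
  | add
  | sub
  | mul
  | div

/-- The meaning of an arithmetic operation in a field. -/
def ArithOp.eval {K : Type*} [Field K] : ArithOp → K → K → K
  | .add, x, y => x + y
  | .sub, x, y => x - y
  | .mul, x, y => x * y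
  | .div, x, y => x / y

/-- Programs that have access to an `n × n` matrix only through its products with vectors, and
that return a value of type `α`. Continuations receive the addresses of the fresh cells. -/
inductive Prog (n : ℕ) (α : Type) : Type
  /-- Stop and return `a`. -/
  | ret (a : α) : Prog n α
  /-- Store the constant `0`. -/
  | zero (k : ℕ → Prog n α) : Prog n α
  /-- Store the constant `1`. -/
  | one (k : ℕ → Prog n α) : Prog n α
  /-- Apply an arithmetic operation to the contents of the cells `a` and `b`. -/
  | arith (o : ArithOp) (a b : ℕ) (k : ℕ → Prog n α) : Prog n α
  /-- Branch according to whether the content of the cell `a` is zero. -/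
  | isZero (a : ℕ) (k : Bool → Prog n α) : Prog n α
  /-- Store a random element, uniform in the sampling set and independent of all others. -/
  | random (k : ℕ → Prog n α) : Prog n α
  /-- Call the black box: multiply the matrix by the vector stored in the cells `v i`. -/
  | blackBox (v : Fin n → ℕ) (k : (Fin n → ℕ) → Prog n α) : Prog n α

namespace Prog

variable {n : ℕ} {α β : Type}

/-- Run a program, then another one that depends on the value returned by the first. -/
def bind : Prog n α → (α → Prog n β) → Prog n β
  | ret a, f => f a
  | zero k, f => zero fun c => (k c).bind f
  | one k, f => one fun c => (k c).bind f
  | arith o a b k, f => arith o a b fun c => (k c).bind f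
  | isZero a k, f => isZero a fun t => (k t).bind f
  | random k, f => random fun c => (k c).bind f
  | blackBox v k, f => blackBox v fun w => (k w).bind f

/-- Replace every call of the black box by a run of the subroutine `box`. -/
def withBlackBox (box : (Fin n → ℕ) → Prog n (Fin n → ℕ)) : Prog n α → Prog n α
  | ret a => ret a
  | zero k => zero fun c => (k c).withBlackBox box
  | one k => one fun c => (k c).withBlackBox box
  | arith o a b k => arith o a b fun c => (k c).withBlackBox box
  | isZero a k => isZero a fun t => (k t).withBlackBox box
  | random k => random fun c => (k c).withBlackBox box
  | blackBox v k => (box v).bind fun w => (k w).withBlackBox box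

/-- Run `f 0, f 1, …, f (m - 1)` one after the other and collect the returned addresses. -/
def sequence : (m : ℕ) → (Fin m → Prog n ℕ) → Prog n (Fin m → ℕ)
  | 0, _ => ret Fin.elim0
  | m + 1, f => (f 0).bind fun a =>
      (sequence m fun i => f i.succ).bind fun as => ret (Fin.cons a as)

end Prog

/-- The content of a memory cell. -/
def read {K : Type*} [Field K] (mem : List K) (a : ℕ) : K := mem.getD a 0

/-- The result of a run: the returned value, the final memory, the number of field operations
performed by the program itself (arithmetic operations, constants, zero tests, random elements)
and the number of calls of the black box. -/
structure Outcome (K : Type*) (α : Type) where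
  value : α
  mem : List K
  ops : ℕ
  calls : ℕ

/-- Account for `a` more field operations and `b` more calls of the black box. -/
def Outcome.charge {K : Type*} {α : Type} (a b : ℕ) (o : Outcome K α) : Outcome K α :=
  { o with ops := o.ops + a, calls := o.calls + b }

/-- The cost of a run, in field operations, when a call of the black box costs `Ω`. -/
def Outcome.cost {K : Type*} {α : Type} (Ω : ℕ) (o : Outcome K α) : ℕ :=
  o.ops + o.calls * Ω

open Classical in
/-- The law of the result of a program that is run from the memory `mem`, with the matrix `A` in
the black box and random elements drawn uniformly from the finite set `S`. -/
noncomputable def Prog.run {K : Type*} [Field K] {n : ℕ} {α : Type}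
    (A : Matrix (Fin n) (Fin n) K) (S : Finset K) (hS : S.Nonempty) :
    Prog n α → List K → PMF (Outcome K α)
  | .ret a, mem => PMF.pure ⟨a, mem, 0, 0⟩
  | .zero k, mem => ((k mem.length).run A S hS (mem ++ [0])).map (Outcome.charge 1 0)
  | .one k, mem => ((k mem.length).run A S hS (mem ++ [1])).map (Outcome.charge 1 0)
  | .arith o a b k, mem =>
      ((k mem.length).run A S hS (mem ++ [o.eval (read mem a) (read mem b)])).map
        (Outcome.charge 1 0)
  | .isZero a k, mem =>
      ((k (decide (read mem a = 0))).run A S hS mem).map (Outcome.charge 1 0)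
  | .random k, mem =>
      (PMF.uniformOfFinset S hS).bind fun x =>
        ((k mem.length).run A S hS (mem ++ [x])).map (Outcome.charge 1 0)
  | .blackBox v k, mem =>
      ((k fun i => mem.length + i).run A S hS
        (mem ++ List.ofFn (A.mulVec fun i => read mem (v i)))).map (Outcome.charge 0 1)

/-- Horner's rule `a₀ v + A (a₁ v + A (a₂ v + ⋯ + A (a_d v)))`, where `A` is the matrix in the
black box, `c i` is the address of `a_i` and `v` are the addresses of the entries of the vector. -/
def horner {n : ℕ} : (d : ℕ) → (c : ℕ → ℕ) → (v : Fin n → ℕ) → Prog n (Fin n → ℕ)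
  | 0, c, v => Prog.sequence n fun i => .arith .mul (c 0) (v i) .ret
  | d + 1, c, v =>
      (horner d (fun i => c (i + 1)) v).bind fun w => .blackBox w fun w' =>
        Prog.sequence n fun i =>
          .arith .mul (c 0) (v i) fun t => .arith .add t (w' i) .ret

/-- The black box for `P(A)ᵉ`: apply `P(A)` by Horner's rule, `e` times. The polynomial `P` has
degree `d` and its coefficients `a₀, …, a_d` are in the cells `0, …, d`. -/
def powerBox (n d : ℕ) : (e : ℕ) → (v : Fin n → ℕ) → Prog n (Fin n → ℕ)
  | 0, v => .ret v
  | e + 1, v => (powerBox n d e v).bind fun w => horner d id w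

/-- The rank step `r = rank(P(A)ᵉ)` of the Nullity algorithm: a black-box rank algorithm is run on
the black box for `P(A)ᵉ`. -/
def rankStep (rankAlg : (n : ℕ) → Prog n ℕ) (n d e : ℕ) : Prog n ℕ :=
  (rankAlg n).withBlackBox (powerBox n d e)

/-- The Nullity algorithm: compute `r = rank(P(A)ᵉ)` and return `(n - r) / deg P`. -/
def nullity (rankAlg : (n : ℕ) → Prog n ℕ) (n d e : ℕ) : Prog n ℕ :=
  (rankStep rankAlg n d e).bind fun r => .ret ((n - r) / d)

/-- The initial memory: the coefficients of `P`, from degree `0` to the degree of `P`. -/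
noncomputable def coeffs {K : Type*} [Field K] (P : Polynomial K) : List K :=
  List.ofFn fun i : Fin (P.natDegree + 1) => P.coeff i

end BlackBox

/-!
Let `B = P(A)ᵉ`. By the primary decomposition, the kernel of `B` is an invariant subspace on which
the characteristic polynomial of `A` is a power of `P`, and which has an invariant complement
where it is prime to `P`. Hence `rank B + d m = n` (`Matrix.rank_aeval_pow_multiplicity`), and
what remains is a rank algorithm with `O(n)` calls of the black box, `O(n²)` other operations and
error probability `O(n² / |S|)`, over every field.

**Preconditioning by a network.** The projected Krylov sequence `u ⬝ Bⁱ v` shows the rank of `B`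
only if the non-zero part of the Frobenius form of `B` is cyclic. So `B` is put into a network
with `5 n` nodes and `O(n)` weighted edges: the matrix `M` of the network (`BlackBox.netMatrix`)
has a row of edge weights for each of the first `4 n` nodes, and the rows of `B` for the last `n`.
Its rank is at most `4 n + r`, where `r = rank B`. For indeterminate weights,
* the characteristic polynomial is of degree at most one in each weight, and it is a power of `X`
  when all weights are zero, so that its irreducible factors other than `X` are simple
  (`MvPolynomial.dvd_X_of_irreducible_sq_dvd`);
* if the network is wired by a concentrator, which exists by counting (`exists_concentrator`),
  then Hall's theorem yields weights `0` and `1` for which `M` permutes all nodes but `n - r`, up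
  to an invertible `r × r` submatrix of `B`; so `X` has multiplicity at most `n - r` in the
  characteristic polynomial (`BlackBox.exists_rootMultiplicity_charpoly_netMatrix_le`).

Hence the characteristic polynomial has a square-free factor of degree at least `4 n + r` prime to
`X`, and a generic vector has a Krylov space of dimension `L = 4 n + r`
(`BlackBox.exists_linearIndependent_genericNet`).

**Error probability.** The Hankel determinants of size `k ≤ L` of the sequence `u ⬝ Mⁱ⁺¹ v` and of
its shift have to be non-zero. The one of size `L` has degree `O(n²)` in the weights and in `u`
and `v`. Where it does not vanish, the others, for the same weights, are non-zero polynomials of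
degree `O(n)` in `u` and `v` alone. So the Schwartz–Zippel lemma gives `O(n² / |S|)`, in spite of
the `O(n)` determinants (`BlackBox.card_netHankel_eq_zero_mul_card_le`).

**Running time.** The size of the largest regular Hankel determinant is read off in `O(n²)`
operations from a division-free form of the continued fraction of the sequence: its rows are the
moments of polynomials that are orthogonal for the sequence or its shift, a polynomial whose
leading entry vanishes lies in the kernel of a Hankel matrix, and so the first such entry is in
row `2 L` (`hankelRow_zero_ne_zero`, `hankelRow_zero_eq_zero`).

**Semantics.** After the random elements have been drawn, the programs are deterministic. Their
results and costs are derived with the predicate `BlackBox.Spec`, a Hoare triple with a count of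
operations and calls.
-/

/-! ### The primary component of an irreducible factor -/

open Polynomial in
/-- The matrix has an eigenvector for the root of `p` in `K[X] / (p)`, to which the minimal
polynomial can be applied. -/
theorem Matrix.irreducible_dvd_minpoly_of_dvd_charpoly {K ι : Type*} [Field K] [Fintype ι]
    [DecidableEq ι] (M : Matrix ι ι K) {p : K[X]} (hp : Irreducible p) (h : p ∣ M.charpoly) :
    p ∣ minpoly K M := by
  have : Fact (Irreducible p) := ⟨hp⟩
  let φ : K →+* AdjoinRoot p := AdjoinRoot.of p
  have hroot : eval (AdjoinRoot.root p) (M.map φ).charpoly = 0 := by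
    rw [Matrix.charpoly_map, eval_map]
    obtain ⟨q, hq⟩ := h
    rw [hq, eval₂_mul, AdjoinRoot.eval₂_root, zero_mul]
  rw [Matrix.eval_charpoly] at hroot
  obtain ⟨v, hv0, hv⟩ := Matrix.exists_mulVec_eq_zero_iff.2 hroot
  have hv' : (M.map φ).mulVec v = AdjoinRoot.root p • v := by
    rw [Matrix.sub_mulVec, sub_eq_zero] at hv
    rw [← hv]
    ext i
    simp [Matrix.scalar_apply, Matrix.mulVec_diagonal]
  have hpow : ∀ k : ℕ, (M.map φ ^ k).mulVec v = AdjoinRoot.root p ^ k • v := by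
    intro k
    induction k with
    | zero => simp
    | succ k ih =>
      rw [pow_succ', ← Matrix.mulVec_mulVec, ih, Matrix.mulVec_smul, hv', smul_smul, pow_succ]
  have hq : ∀ q : K[X], ((aeval M q).map φ).mulVec v = q.eval₂ φ (AdjoinRoot.root p) • v := by
    intro q
    induction q using Polynomial.induction_on' with
    | add a b ha hb =>
      rw [map_add, Matrix.map_add _ (map_add φ), Matrix.add_mulVec, ha, hb, eval₂_add, add_smul]
    | monomial k a =>
      have h1 : (aeval M (monomial k a)).map φ = φ a • M.map φ ^ k := by
        rw [aeval_monomial, ← RingHom.mapMatrix_apply, map_mul, map_pow, RingHom.mapMatrix_apply,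
          RingHom.mapMatrix_apply, Algebra.algebraMap_eq_smul_one,
          Matrix.map_smul' _ _ _ (map_mul φ), Matrix.map_one _ (map_zero φ) (map_one φ),
          smul_one_mul]
      rw [h1, Matrix.smul_mulVec, hpow, smul_smul, eval₂_monomial]
  have h0 := hq (minpoly K M)
  rw [minpoly.aeval, Matrix.map_zero _ (map_zero φ), Matrix.zero_mulVec, eq_comm,
    smul_eq_zero] at h0
  have h1 := h0.resolve_right hv0
  rw [← AdjoinRoot.mk_eq_zero, ← AdjoinRoot.aeval_eq]
  exact h1

open Polynomial in
theorem LinearMap.irreducible_dvd_minpoly_of_dvd_charpoly {K E : Type*} [Field K]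
    [AddCommGroup E] [Module K E] [FiniteDimensional K E] (f : E →ₗ[K] E) {p : K[X]}
    (hp : Irreducible p) (h : p ∣ f.charpoly) : p ∣ minpoly K f := by
  let b := Module.Free.chooseBasis K E
  rw [← LinearMap.minpoly_toMatrix b]
  refine Matrix.irreducible_dvd_minpoly_of_dvd_charpoly _ hp ?_
  rwa [LinearMap.charpoly_toMatrix]

open Polynomial in
theorem LinearMap.charpoly_eq_mul_of_isCompl {K E : Type*} [Field K]
    [AddCommGroup E] [Module K E] [FiniteDimensional K E] (f : E →ₗ[K] E) {U W : Submodule K E}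
    (hUW : IsCompl U W) (hU : ∀ x ∈ U, f x ∈ U) (hW : ∀ x ∈ W, f x ∈ W) :
    f.charpoly = (f.restrict hU).charpoly * (f.restrict hW).charpoly := by
  let e := Submodule.prodEquivOfIsCompl U W hUW
  have h : (f.restrict hU).prodMap (f.restrict hW) = e.symm.conj f := by
    refine LinearMap.ext fun x => ?_
    rw [LinearEquiv.conj_apply_apply, LinearEquiv.eq_symm_apply]
    simp [e]
  rw [← LinearMap.charpoly_prodMap, h, LinearEquiv.charpoly_conj]

open Polynomial in
theorem LinearMap.associated_charpoly_pow {K E : Type*} [Field K] [AddCommGroup E] [Module K E]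
    [FiniteDimensional K E] (g : E →ₗ[K] E) {P : K[X]} (hP : Irreducible P) {e : ℕ}
    (h : minpoly K g ∣ P ^ e) : ∃ s, Associated g.charpoly (P ^ s) := by
  have hfin : FiniteMultiplicity P g.charpoly :=
    FiniteMultiplicity.of_not_isUnit hP.not_isUnit g.charpoly_monic.ne_zero
  obtain ⟨c, hc, hPc⟩ := hfin.exists_eq_pow_mul_and_not_dvd
  refine ⟨multiplicity P g.charpoly, ?_⟩
  by_cases hu : IsUnit c
  · nth_rw 1 [hc]
    exact (associated_mul_isUnit_left_iff hu).2 (Associated.refl _)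
  · have hc0 : c ≠ 0 := fun h0 => g.charpoly_monic.ne_zero (by rw [hc, h0, mul_zero])
    obtain ⟨q, hq, hqc⟩ := WfDvdMonoid.exists_irreducible_factor hu hc0
    have h1 : q ∣ P ^ e := (LinearMap.irreducible_dvd_minpoly_of_dvd_charpoly g hq
      (hqc.trans (hc ▸ Dvd.intro_left _ rfl))).trans h
    have h2 : q ∣ P := hq.prime.dvd_of_dvd_pow h1
    exact absurd (((hq.associated_of_dvd hP h2).symm.dvd).trans hqc) hPc

open Polynomial in
/-- The kernel of `P(A)ᵉ` is the `P`-primary component of the space: the characteristic polynomial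
of `A` on it is a power of `P`, and on the complement it is prime to `P`. -/
theorem Matrix.rank_aeval_pow_multiplicity {K ι : Type*} [Field K] [Fintype ι] [DecidableEq ι]
    (A : Matrix ι ι K) {P : K[X]} (hP : Irreducible P) :
    (aeval A P ^ multiplicity P (minpoly K A)).rank +
      P.natDegree * multiplicity P A.charpoly = Fintype.card ι := by
  set e := multiplicity P (minpoly K A)
  let f := Matrix.toLin' A
  have hmin0 : minpoly K A ≠ 0 := minpoly.ne_zero A.isIntegral
  have hfin : FiniteMultiplicity P (minpoly K A) :=
    FiniteMultiplicity.of_not_isUnit hP.not_isUnit hmin0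
  obtain ⟨Q, hQ, hPQ⟩ := hfin.exists_eq_pow_mul_and_not_dvd
  have hcop : IsCoprime (P ^ e) Q :=
    ((hP.coprime_iff_not_dvd).2 hPQ).pow_left
  let U := LinearMap.ker (aeval f (P ^ e))
  let W := LinearMap.ker (aeval f Q)
  have hUW : IsCompl U W := by
    refine ⟨disjoint_ker_aeval_of_isCoprime f hcop, ?_⟩
    rw [codisjoint_iff, sup_ker_aeval_eq_ker_aeval_mul_of_coprime f hcop, ← hQ]
    have : aeval f (minpoly K A) = 0 := by
      rw [← Matrix.minpoly_toLin']
      exact minpoly.aeval K f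
    rw [this, LinearMap.ker_zero]
  have hinv : ∀ q : K[X], ∀ x ∈ LinearMap.ker (aeval f q), f x ∈ LinearMap.ker (aeval f q) := by
    intro q x hx
    rw [LinearMap.mem_ker] at hx ⊢
    have : aeval f q * f = f * aeval f q := by
      have := (Commute.all q X).map (aeval f)
      simpa using this.eq
    rw [← Module.End.mul_apply, this, Module.End.mul_apply, hx, map_zero]
  have hann : ∀ q : K[X], minpoly K (f.restrict (hinv q)) ∣ q := by
    intro q
    apply minpoly.dvd
    ext x
    have h1 : ∀ (r : K[X]) (y : LinearMap.ker (aeval f q)),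
        ((aeval (f.restrict (hinv q)) r y : LinearMap.ker (aeval f q)) : ι → K) =
          aeval f r (y : ι → K) := by
      intro r y
      induction r using Polynomial.induction_on' with
      | add a b ha hb => simp [ha, hb]
      | monomial k a =>
        simp only [aeval_monomial, Module.End.mul_apply, Module.algebraMap_end_apply,
          Submodule.coe_smul]
        congr 1
        rw [Module.End.pow_restrict, LinearMap.coe_restrict_apply]
    rw [h1 q x]
    simp only [LinearMap.mem_ker.1 x.2, LinearMap.zero_apply, ZeroMemClass.coe_zero, Pi.zero_apply]
  have hchar : A.charpoly = (f.restrict (hinv (P ^ e))).charpoly *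
      (f.restrict (hinv Q)).charpoly := by
    rw [← LinearMap.charpoly_eq_mul_of_isCompl f hUW (hinv _) (hinv _),
      Matrix.charpoly_toLin']
  set g := f.restrict (hinv (P ^ e))
  have hndvd : ¬ P ∣ (f.restrict (hinv Q)).charpoly := fun h =>
    hPQ ((LinearMap.irreducible_dvd_minpoly_of_dvd_charpoly _ hP h).trans (hann Q))
  have hg0 : g.charpoly ≠ 0 := g.charpoly_monic.ne_zero
  obtain ⟨s, hs⟩ := LinearMap.associated_charpoly_pow g hP (hann (P ^ e))
  have hdeg : Module.finrank K U = P.natDegree * s := by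
    rw [← LinearMap.charpoly_natDegree g,
      natDegree_eq_of_degree_eq (degree_eq_degree_of_associated hs), natDegree_pow, mul_comm]
  have hmul : multiplicity P A.charpoly = s := by
    apply multiplicity_eq_of_dvd_of_not_dvd
    · rw [hchar]
      exact (hs.symm.dvd).mul_right _
    · intro h
      apply hndvd
      rw [hchar] at h
      have h2 : P ^ (s + 1) ∣ P ^ s * (f.restrict (hinv Q)).charpoly :=
        h.trans (mul_dvd_mul_right hs.dvd _)
      rw [pow_succ] at h2
      exact (mul_dvd_mul_iff_left (pow_ne_zero _ hP.ne_zero)).1 h2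
  have hrank := LinearMap.finrank_range_add_finrank_ker (aeval f (P ^ e))
  rw [Module.finrank_fintype_fun_eq_card] at hrank
  rw [hmul, ← hdeg, ← hrank]
  congr 1
  have : (aeval A P ^ e).mulVecLin = aeval f (P ^ e) := by
    rw [← map_pow]
    have := Polynomial.aeval_algHom_apply
      (Matrix.toLinAlgEquiv' (R := K) (n := ι)).toAlgHom A (P ^ e)
    exact this.symm
  rw [Matrix.rank, this]

/-! ### Concentrators -/

/-- A term of the union bound in `exists_concentrator`. -/
theorem choose_mul_choose_mul_pow_le {n k : ℕ} (hk : 1 ≤ k) (hkn : k ≤ 2 * n) :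
    ((5 * n).choose k * (3 * n).choose k * k ^ (12 * k) : ℝ) ≤
      (1 / 4) ^ k * (3 * n) ^ (12 * k) := by
  have hk0 : (0 : ℝ) < k := by exact_mod_cast hk
  have hfac : (k : ℝ) ^ k / k.factorial ≤ 2.72 ^ k := by
    calc (k : ℝ) ^ k / k.factorial ≤ Real.exp k := Real.pow_div_factorial_le_exp _ hk0.le k
      _ = Real.exp 1 ^ k := by rw [← Real.exp_nat_mul, mul_one]
      _ ≤ 2.72 ^ k := by
        gcongr
        exact Real.exp_one_lt_d9.le.trans (by norm_num)
  have h1 : ((5 * n).choose k : ℝ) ≤ (5 * n : ℝ) ^ k / k.factorial := by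
    exact_mod_cast Nat.choose_le_pow_div k (5 * n)
  have h2 : ((3 * n).choose k : ℝ) ≤ (3 * n : ℝ) ^ k / k.factorial := by
    exact_mod_cast Nat.choose_le_pow_div k (3 * n)
  have hkn' : (k : ℝ) ≤ 2 * n := by exact_mod_cast hkn
  calc ((5 * n).choose k * (3 * n).choose k * k ^ (12 * k) : ℝ)
      ≤ ((5 * n : ℝ) ^ k / k.factorial) * ((3 * n : ℝ) ^ k / k.factorial) * k ^ (12 * k) := by
        gcongr
    _ = (5 * n : ℝ) ^ k * (3 * n : ℝ) ^ k * ((k : ℝ) ^ k / k.factorial) ^ 2 *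
          ((k : ℝ) ^ 10) ^ k := by
        rw [show (k : ℝ) ^ (12 * k) = ((k : ℝ) ^ k) ^ 2 * ((k : ℝ) ^ 10) ^ k by
          rw [← pow_mul, ← pow_mul, ← pow_add]; congr 1; ring]
        ring
    _ ≤ (5 * n : ℝ) ^ k * (3 * n : ℝ) ^ k * (2.72 ^ k) ^ 2 * ((2 * n : ℝ) ^ 10) ^ k := by
        gcongr
    _ = ((5 * 3 * 2.72 ^ 2 * 2 ^ 10 / 3 ^ 12) * (3 * n : ℝ) ^ 12) ^ k := by
        rw [← pow_mul, mul_comm k 2, pow_mul, ← mul_pow, ← mul_pow, ← mul_pow]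
        congr 1
        ring
    _ ≤ ((1 / 4) * (3 * n : ℝ) ^ 12) ^ k := by
        refine pow_le_pow_left₀ (by positivity) ?_ k
        exact mul_le_mul_of_nonneg_right (by norm_num) (by positivity)
    _ = (1 / 4) ^ k * (3 * n) ^ (12 * k) := by rw [mul_pow, pow_mul]

/-- Bipartite graphs of bounded degree in which every small set of inputs has at least as many
neighbours as elements. The proof is a union bound: a random graph has a set of `k` inputs whose
neighbours lie in a set of `k` outputs with probability at most `4⁻ᵏ`, summed over all pairs of such
sets. -/
theorem exists_concentrator (n : ℕ) {α : Type} [Fintype α] [DecidableEq α]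
    (hα : Fintype.card α = 5 * n) :
    ∃ f : α → Fin 12 → Fin (3 * n), ∀ X : Finset α, X.card ≤ 2 * n →
      X.card ≤ (X.biUnion fun a => Finset.univ.image (f a)).card := by
  by_contra! hbad
  -- the graphs in which all neighbours of `X` lie in `Y`
  let bad : ℕ → Finset α → Finset (Fin (3 * n)) → Finset (α → Fin 12 → Fin (3 * n)) :=
    fun _ X Y => Fintype.piFinset fun a => Fintype.piFinset fun _ => if a ∈ X then Y else .univ
  have hcover : (Finset.univ : Finset (α → Fin 12 → Fin (3 * n))) ⊆
      (Finset.Icc 1 (2 * n)).biUnion fun k =>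
        ((Finset.univ : Finset α).powersetCard k).biUnion fun X =>
          ((Finset.univ : Finset (Fin (3 * n))).powersetCard k).biUnion fun Y => bad k X Y := by
    intro f _
    obtain ⟨X, hX, hlt⟩ := hbad f
    obtain ⟨Y, hY, hYc⟩ := Finset.exists_superset_card_eq hlt.le
      (by rw [Fintype.card_fin]; omega)
    simp only [Finset.mem_biUnion, Finset.mem_Icc, Finset.mem_powersetCard_univ]
    refine ⟨X.card, ⟨by omega, hX⟩, X, rfl, Y, hYc, ?_⟩
    simp only [bad, Fintype.mem_piFinset]
    intro a i
    split_ifs with ha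
    · exact hY (Finset.mem_biUnion.2 ⟨a, ha, Finset.mem_image_of_mem _ (Finset.mem_univ i)⟩)
    · exact Finset.mem_univ _
  have hbadcard : ∀ k X Y, X.card = k → Y.card = k →
      (bad k X Y).card = k ^ (12 * k) * (3 * n) ^ (12 * (5 * n - k)) := by
    intro k X Y hX hY
    have hsplit : ∀ a, (if a ∈ X then Y else Finset.univ).card =
        if a ∈ X then k else 3 * n := by
      intro a
      split_ifs <;> simp [hY]
    simp only [bad, Fintype.card_piFinset, hsplit, Finset.prod_const, Finset.card_univ,
      Fintype.card_fin]
    rw [Finset.prod_pow, Finset.prod_ite, Finset.prod_const, Finset.prod_const,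
      Finset.filter_mem_eq_inter, Finset.univ_inter, hX, Finset.filter_notMem_eq_sdiff,
      Finset.card_sdiff_of_subset (Finset.subset_univ _), Finset.card_univ, hα, hX, mul_pow,
      ← pow_mul, ← pow_mul, mul_comm k, mul_comm (5 * n - k)]
  have hcount : (3 * n) ^ (12 * (5 * n)) ≤ ∑ k ∈ Finset.Icc 1 (2 * n),
      (5 * n).choose k * ((3 * n).choose k * (k ^ (12 * k) * (3 * n) ^ (12 * (5 * n - k)))) := by
    calc (3 * n) ^ (12 * (5 * n)) =
          (Finset.univ : Finset (α → Fin 12 → Fin (3 * n))).card := by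
          rw [Finset.card_univ]
          simp [hα, pow_mul]
      _ ≤ _ := (Finset.card_le_card hcover).trans Finset.card_biUnion_le
      _ ≤ _ := by
        refine Finset.sum_le_sum fun k _ => ?_
        refine Finset.card_biUnion_le.trans ?_
        refine (Finset.sum_le_card_nsmul _ _
          ((3 * n).choose k * (k ^ (12 * k) * (3 * n) ^ (12 * (5 * n - k)))) ?_).trans ?_
        · intro X hX
          refine Finset.card_biUnion_le.trans ?_
          rw [Finset.sum_congr rfl fun Y hY => hbadcard k X Y
            (Finset.mem_powersetCard_univ.1 hX) (Finset.mem_powersetCard_univ.1 hY)]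
          simp
        · simp [hα]
  rcases Nat.eq_zero_or_pos n with rfl | hn
  · simp at hcount
  have hpos : (0 : ℝ) < (3 * n : ℝ) ^ (12 * (5 * n)) := by positivity
  have hreal : (3 * n : ℝ) ^ (12 * (5 * n)) ≤
      ∑ k ∈ Finset.Icc 1 (2 * n), (1 / 4 : ℝ) ^ k * (3 * n : ℝ) ^ (12 * (5 * n)) := by
    have hcast : (3 * n : ℝ) ^ (12 * (5 * n)) ≤ ∑ k ∈ Finset.Icc 1 (2 * n),
        ((5 * n).choose k * ((3 * n).choose k *
          (k ^ (12 * k) * (3 * n) ^ (12 * (5 * n - k)))) : ℝ) := by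
      exact_mod_cast hcount
    refine hcast.trans (Finset.sum_le_sum fun k hk => ?_)
    rw [Finset.mem_Icc] at hk
    have := choose_mul_choose_mul_pow_le hk.1 hk.2
    calc _ = ((5 * n).choose k * (3 * n).choose k * k ^ (12 * k) : ℝ) *
            (3 * n : ℝ) ^ (12 * (5 * n - k)) := by ring
      _ ≤ ((1 / 4) ^ k * (3 * n) ^ (12 * k)) * (3 * n : ℝ) ^ (12 * (5 * n - k)) := by gcongr
      _ = _ := by
        rw [mul_assoc, ← pow_add, ← mul_add, Nat.add_sub_of_le (by omega)]
  rw [← Finset.sum_mul] at hreal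
  have hgeom : ∑ k ∈ Finset.Icc 1 (2 * n), (1 / 4 : ℝ) ^ k < 1 := by
    rw [← Finset.Ico_add_one_right_eq_Icc, geom_sum_Ico (by norm_num) (by omega)]
    have : (0 : ℝ) < (1 / 4) ^ (2 * n + 1) := by positivity
    rw [div_lt_iff_of_neg (by norm_num)]
    linarith
  nlinarith

/-! ### Networks around a black box -/

namespace BlackBox

/-- The nodes of the network that receive an output of an edge. The last `n` of them are the
entries of the vector to which the black box is applied. -/
abbrev Inner (n : ℕ) : Type := Fin (3 * n) ⊕ Fin n

/-- The nodes of the network. The last `n` of them receive the result of the black box. -/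
abbrev Node (n : ℕ) : Type := Inner n ⊕ Fin n

/-- The edges of the network: twelve that leave each node, and twelve that arrive at each node that
does not receive a result of the black box. -/
abbrev Edge (n : ℕ) : Type := (Node n × Fin 12) ⊕ (Inner n × Fin 12)

/-- The head of an edge, in the network wired according to `f`. -/
def Edge.head {n : ℕ} (f : Node n → Fin 12 → Fin (3 * n)) : Edge n → Inner n
  | .inl (x, i) => .inl (f x i)
  | .inr (q, _) => q

/-- The tail of an edge, in the network wired according to `f`. -/
def Edge.tail {n : ℕ} (f : Node n → Fin 12 → Fin (3 * n)) : Edge n → Node n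
  | .inl (x, _) => x
  | .inr (q, i) => .inl (.inl (f (.inl q) i))

/-- Every set of at most `2 n` nodes has at least as many neighbours as elements. -/
def IsConcentrator {n : ℕ} (f : Node n → Fin 12 → Fin (3 * n)) : Prop :=
  ∀ X : Finset (Node n), X.card ≤ 2 * n →
    X.card ≤ (X.biUnion fun a => Finset.univ.image (f a)).card

theorem exists_isConcentrator (n : ℕ) : ∃ f : Node n → Fin 12 → Fin (3 * n), IsConcentrator f :=
  exists_concentrator n (by simp; ring)

/-- The nodes that remain as tails when the inputs in `J` of the black box and its outputs outside
`I` are left out. -/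
def tails {n : ℕ} (I J : Finset (Fin n)) : Finset (Node n) :=
  (Finset.univ.disjSum Jᶜ).disjSum I

theorem card_tails {n : ℕ} {I J : Finset (Fin n)} (h : I.card = J.card) :
    (tails I J).card = 4 * n := by
  have := J.card_le_univ
  simp only [tails, Finset.card_disjSum, Finset.card_univ, Fintype.card_fin, Finset.card_compl, h]
    at *
  omega

/-- Hall's condition, for the tails of a network wired by a concentrator: small sets have enough
neighbours because of the edges that leave each node, and large sets because of the edges that
arrive at each node. -/
theorem card_le_card_biUnion_heads {n : ℕ} {f : Node n → Fin 12 → Fin (3 * n)}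
    (hf : IsConcentrator f) {I J : Finset (Fin n)} (h : I.card = J.card) {X : Finset (Node n)}
    (hX : X ⊆ tails I J) :
    X.card ≤ (X.biUnion fun x => Finset.univ.filter fun q =>
      ∃ e, Edge.head f e = q ∧ Edge.tail f e = x).card := by
  by_cases hcard : X.card ≤ 2 * n
  · refine (hf X hcard).trans ?_
    rw [← Finset.card_map (Function.Embedding.inl (β := Fin n))]
    refine Finset.card_le_card fun q hq => ?_
    simp only [Finset.mem_map, Finset.mem_biUnion, Finset.mem_image, Finset.mem_univ, true_and,
      Finset.mem_filter, Function.Embedding.inl_apply] at hq ⊢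
    obtain ⟨_, ⟨x, hx, i, rfl⟩, rfl⟩ := hq
    exact ⟨x, hx, .inl (x, i), rfl, rfl⟩
  · by_contra! hlt
    set Y := X.biUnion fun x => Finset.univ.filter fun q =>
      ∃ e, Edge.head f e = q ∧ Edge.tail f e = x with hY
    have hXle : X.card ≤ 4 * n := card_tails h ▸ Finset.card_le_card hX
    have hYc : 4 * n + 1 - X.card ≤ Yᶜ.card := by
      rw [Finset.card_compl]
      simp only [Fintype.card_sum, Fintype.card_fin]
      omega
    -- the many heads that `X` misses have many neighbours among the tails, none of them in `X`
    obtain ⟨Z, hZY, hZ⟩ := Finset.exists_subset_card_eq hYc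
    have h1 := hf (Z.map .inl) (by rw [Finset.card_map]; omega)
    rw [Finset.card_map, ← Finset.card_map
      (Function.Embedding.inl.trans Function.Embedding.inl : Fin (3 * n) ↪ Node n)] at h1
    have h2 := h1.trans (Finset.card_le_card (t := tails I J \ X) (by
        intro y hy
        simp only [Finset.mem_map, Finset.mem_biUnion, Finset.mem_image, Finset.mem_univ, true_and,
          Function.Embedding.trans_apply, Function.Embedding.inl_apply] at hy
        obtain ⟨_, ⟨_, ⟨q, hq, rfl⟩, i, rfl⟩, rfl⟩ := hy
        rw [Finset.mem_sdiff]
        refine ⟨by simp [tails], fun hmem => ?_⟩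
        have := hZY hq
        rw [Finset.mem_compl] at this
        apply this
        rw [hY, Finset.mem_biUnion]
        exact ⟨_, hmem, Finset.mem_filter.2 ⟨Finset.mem_univ _, .inr (q, i), rfl, rfl⟩⟩))
    rw [Finset.card_sdiff_of_subset hX, card_tails h] at h2
    omega

/-- In a network wired by a concentrator, the nodes that are heads of edges can be matched with any
choice of `tails`. -/
theorem exists_matching {n : ℕ} {f : Node n → Fin 12 → Fin (3 * n)}
    (hf : IsConcentrator f) {I J : Finset (Fin n)} (h : I.card = J.card) :
    ∃ s : Inner n → Edge n, (∀ q, Edge.head f (s q) = q) ∧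
      ∀ x ∈ tails I J, ∃ q, Edge.tail f (s q) = x := by
  have hall := (Finset.all_card_le_biUnion_card_iff_exists_injective
    (fun x : tails I J => Finset.univ.filter fun q =>
      ∃ e, Edge.head f e = q ∧ Edge.tail f e = x)).1 (by
    intro X
    have := card_le_card_biUnion_heads hf h (X := X.map (.subtype _)) (by
      intro x hx
      obtain ⟨y, -, rfl⟩ := Finset.mem_map.1 hx
      exact y.2)
    rw [Finset.card_map] at this
    refine this.trans (Finset.card_le_card ?_)
    intro q hq
    simp only [Finset.mem_biUnion, Finset.mem_map] at hq ⊢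
    obtain ⟨_, ⟨y, hy, rfl⟩, hq⟩ := hq
    exact ⟨y, hy, hq⟩)
  obtain ⟨g, hg, hge⟩ := hall
  have hbij : Function.Bijective g := by
    rw [Fintype.bijective_iff_injective_and_card]
    refine ⟨hg, ?_⟩
    rw [Fintype.card_coe, card_tails h]
    simp only [Fintype.card_sum, Fintype.card_fin]
    ring
  simp only [Finset.mem_filter, Finset.mem_univ, true_and] at hge
  choose e he using hge
  let E := Equiv.ofBijective g hbij
  refine ⟨fun q => e (E.symm q), fun q => ?_, fun x hx => ⟨g ⟨x, hx⟩, ?_⟩⟩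
  · rw [(he _).1]
    exact E.apply_symm_apply q
  · rw [(he _).2]
    exact congrArg Subtype.val (E.symm_apply_apply ⟨x, hx⟩)

/-- The matrix of the network with edge weights `w` and with the matrix `B` in the black box. -/
def netMatrix {n : ℕ} (f : Node n → Fin 12 → Fin (3 * n)) {R : Type*} [CommRing R]
    (B : Matrix (Fin n) (Fin n) R) (w : Edge n → R) : Matrix (Node n) (Node n) R :=
  Matrix.of <| Sum.elim
    (fun q y => ∑ e, if Edge.head f e = q ∧ Edge.tail f e = y then w e else 0)
    (fun a => Sum.elim (Sum.elim 0 (B a)) 0)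

section netMatrix

variable {n : ℕ} (f : Node n → Fin 12 → Fin (3 * n)) {R : Type*} [CommRing R]
  (B : Matrix (Fin n) (Fin n) R) (w : Edge n → R)

theorem netMatrix_mulVec_inl (x : Node n → R) (q : Inner n) :
    (netMatrix f B w).mulVec x (.inl q) =
      ∑ e, if Edge.head f e = q then w e * x (Edge.tail f e) else 0 := by
  simp only [netMatrix, Matrix.mulVec, dotProduct, Matrix.of_apply, Sum.elim_inl, Finset.sum_mul]
  rw [Finset.sum_comm]
  refine Finset.sum_congr rfl fun e _ => ?_
  by_cases h : Edge.head f e = q <;> simp [h]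

theorem netMatrix_mulVec_inr (x : Node n → R) (a : Fin n) :
    (netMatrix f B w).mulVec x (.inr a) = B.mulVec (fun c => x (.inl (.inr c))) a := by
  simp [netMatrix, Matrix.mulVec, dotProduct]

theorem map_netMatrix {R' : Type*} [CommRing R'] (φ : R →+* R') :
    (netMatrix f B w).map φ = netMatrix f (B.map φ) (φ ∘ w) := by
  ext i j
  rcases i with q | a
  · simp [netMatrix, map_sum, apply_ite φ]
  · rcases j with (j | j) | j <;> simp [netMatrix]

end netMatrix

end BlackBox

/-! ### The rank of a network -/

theorem Matrix.exists_linearIndependent_col {K m n : Type*} [Field K] [Fintype m] [Fintype n]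
    (B : Matrix m n K) : ∃ c : Fin B.rank → n, LinearIndependent K fun i => B.col (c i) := by
  obtain ⟨f, hf, -, hind⟩ := Submodule.exists_fun_fin_finrank_span_eq K (Set.range B.col)
  choose c hc using hf
  have hr : B.rank = Module.finrank K (Submodule.span K (Set.range B.col)) :=
    B.rank_eq_finrank_span_cols
  refine ⟨fun i => c (Fin.cast hr i), ?_⟩
  simp only [hc]
  exact hind.comp _ (Fin.cast_injective hr)

/-- A matrix of rank `r` has an invertible `r × r` submatrix. -/
theorem Matrix.exists_rank_det_ne_zero {K m n : Type*} [Field K] [Fintype m] [Fintype n]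
    (B : Matrix m n K) :
    ∃ (a : Fin B.rank → m) (c : Fin B.rank → n), (B.submatrix a c).det ≠ 0 := by
  obtain ⟨c, hc⟩ := B.exists_linearIndependent_col
  let C := (B.submatrix id c).transpose
  have hr : B.rank = C.rank := by
    have : LinearIndependent K C.row := hc
    rw [this.rank_matrix, Fintype.card_fin]
  obtain ⟨a, ha⟩ := C.exists_linearIndependent_col
  refine ⟨fun i => a (Fin.cast hr i), c, ?_⟩
  have hrow : LinearIndependent K (B.submatrix (fun i => a (Fin.cast hr i)) c).row :=
    ha.comp _ (Fin.cast_injective hr)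
  exact ((Matrix.isUnit_iff_isUnit_det _).1
    (Matrix.linearIndependent_rows_iff_isUnit.1 hrow)).ne_zero

theorem Matrix.rank_add_le_rank_add_rank {K m n : Type*} [Field K] [Fintype m] [Fintype n]
    (A B : Matrix m n K) : (A + B).rank ≤ A.rank + B.rank := by
  rw [Matrix.rank, Matrix.rank, Matrix.rank, Matrix.mulVecLin_add]
  refine le_trans (Submodule.finrank_mono ?_)
    (Submodule.finrank_add_le_finrank_add_finrank _ _)
  rintro _ ⟨x, rfl⟩
  exact Submodule.add_mem_sup ⟨x, rfl⟩ ⟨x, rfl⟩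

namespace BlackBox

section netMatrix

variable {n : ℕ} (f : Node n → Fin 12 → Fin (3 * n)) {K : Type*} [Field K]
  (B : Matrix (Fin n) (Fin n) K)

theorem rank_netMatrix_le (w : Edge n → K) : (netMatrix f B w).rank ≤ 4 * n + B.rank := by
  have hsplit : netMatrix f B w = netMatrix f 0 w +
      (Matrix.of fun (i : Node n) (a : Fin n) => if i = .inr a then (1 : K) else 0) * B *
        (Matrix.of fun (c : Fin n) (j : Node n) => if j = .inl (.inr c) then (1 : K) else 0) := by
    ext i j
    rcases i with q | a <;> rcases j with (j | j) | j <;>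
      simp [-Fintype.sum_sum_type, netMatrix, Matrix.mul_apply]
  rw [hsplit]
  refine (Matrix.rank_add_le_rank_add_rank _ _).trans (add_le_add ?_ ?_)
  · refine (Matrix.rank_le_card_of_support_subset _ (Finset.univ.map .inl) ?_).trans_eq ?_
    · rw [Function.support_subset_iff']
      rintro (q | a) h
      · simp at h
      · funext j
        rcases j with (j | j) | j <;> simp [netMatrix, Matrix.row]
    · simp only [Finset.card_map, Finset.card_univ, Fintype.card_sum, Fintype.card_fin]
      ring
  · exact (Matrix.rank_mul_le_left _ _).trans (Matrix.rank_mul_le_right _ _)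

open Polynomial in
theorem charpoly_netMatrix_zero : (netMatrix f B 0).charpoly = X ^ (5 * n) := by
  have hnil : IsNilpotent (Matrix.toLin' (netMatrix f B 0)) := by
    refine ⟨2, LinearMap.ext fun x => ?_⟩
    rw [pow_two, Module.End.mul_apply, Matrix.toLin'_apply, Matrix.toLin'_apply]
    funext i
    rcases i with q | a
    · rw [netMatrix_mulVec_inl]
      simp [-Fintype.sum_sum_type]
    · rw [netMatrix_mulVec_inr]
      have : (fun c => (netMatrix f B 0).mulVec x (.inl (.inr c))) = 0 := by
        funext c
        rw [netMatrix_mulVec_inl]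
        simp [-Fintype.sum_sum_type]
      rw [this, Matrix.mulVec_zero]
      rfl
  have := hnil.charpoly_eq_X_pow_finrank
  rw [Matrix.charpoly_toLin', Module.finrank_fintype_fun_eq_card] at this
  rw [this]
  congr 1
  simp only [Fintype.card_sum, Fintype.card_fin]
  ring

open Polynomial in
/-- If the black box of a network wired by a concentrator has rank `r`, some weights turn the
network into a permutation of all nodes but `n - r`, up to an invertible `r × r` matrix. -/
theorem exists_rootMultiplicity_charpoly_netMatrix_le (hf : IsConcentrator f) :
    ∃ w : Edge n → K, (netMatrix f B w).charpoly.rootMultiplicity 0 + B.rank ≤ n := by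
  obtain ⟨a, c, hdet⟩ := B.exists_rank_det_ne_zero
  have ha : Function.Injective a := by
    intro i j hij
    by_contra hne
    exact hdet (Matrix.det_zero_of_row_eq hne (by funext k; simp [hij]))
  have hc : Function.Injective c := by
    intro i j hij
    by_contra hne
    exact hdet (Matrix.det_zero_of_column_eq hne (by intro k; simp [hij]))
  let I := Finset.univ.map ⟨a, ha⟩
  let J := Finset.univ.map ⟨c, hc⟩
  have hIJ : I.card = J.card := by simp [I, J]
  obtain ⟨s, hs, hsur⟩ := exists_matching hf hIJ
  refine ⟨fun e => if e = s (Edge.head f e) then 1 else 0, ?_⟩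
  set M := netMatrix f B fun e => if e = s (Edge.head f e) then 1 else 0 with hM
  have hMinl : ∀ x q, M.mulVec x (.inl q) = x (Edge.tail f (s q)) := by
    intro x q
    rw [hM, netMatrix_mulVec_inl, Finset.sum_eq_single (s q)]
    · simp [hs]
    · intro e _ he
      by_cases h1 : Edge.head f e = q
      · rw [if_pos h1, h1, if_neg he, zero_mul]
      · rw [if_neg h1]
    · simp
  -- the vectors supported on the outputs of the black box that are left out
  let T : Submodule K (Node n → K) := ⨅ x ∈ tails I J ∪ Finset.univ.map .inl,
    LinearMap.ker (LinearMap.proj x : (Node n → K) →ₗ[K] K)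
  have hT : ∀ y, y ∈ T ↔ (∀ q, y (.inl q) = 0) ∧ ∀ i, y (.inr (a i)) = 0 := by
    intro y
    simp only [T, Submodule.mem_iInf, LinearMap.mem_ker, LinearMap.proj_apply]
    constructor
    · refine fun h => ⟨fun q => h _ (by simp), fun i => h _ (by simp [tails, I])⟩
    · rintro ⟨h1, h2⟩ x hx
      rcases x with q | b
      · exact h1 q
      · simp only [tails, I, Finset.mem_union, Finset.inr_mem_disjSum, Finset.mem_map,
          Finset.mem_univ, true_and, Function.Embedding.coeFn_mk,
          Function.Embedding.inl_apply, reduceCtorEq, exists_false, or_false] at hx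
        obtain ⟨i, rfl⟩ := hx
        exact h2 i
  have hstep : ∀ y, M.mulVec y ∈ T → y ∈ T := by
    intro y hy
    rw [hT] at hy ⊢
    obtain ⟨h1, h2⟩ := hy
    have htails : ∀ x ∈ tails I J, y x = 0 := by
      intro x hx
      obtain ⟨q, rfl⟩ := hsur x hx
      rw [← hMinl y]
      exact h1 q
    have hJ : ∀ j, j ∉ J → y (.inl (.inr j)) = 0 := fun j hj =>
      htails _ (by simpa [tails] using hj)
    have hsub : (B.submatrix a c).mulVec (fun k => y (.inl (.inr (c k)))) = 0 := by
      funext i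
      have := h2 i
      rw [hM, netMatrix_mulVec_inr] at this
      simp only [Matrix.mulVec, dotProduct, Matrix.submatrix_apply, Pi.zero_apply] at this ⊢
      rw [← this, ← Finset.sum_subset (Finset.subset_univ J)]
      · simp [J]
      · intro j _ hj
        rw [hJ j hj, mul_zero]
    have hJ' := Matrix.eq_zero_of_mulVec_eq_zero hdet hsub
    refine ⟨fun q => ?_, fun i => htails _ (by simp [tails, I])⟩
    rcases q with q | j
    · exact htails _ (by simp [tails])
    · by_cases hj : j ∈ J
      · obtain ⟨k, -, rfl⟩ := Finset.mem_map.1 hj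
        exact congrFun hJ' k
      · exact hJ j hj
  have hle : Module.End.maxGenEigenspace (Matrix.toLin' M) 0 ≤ T := by
    intro x hx
    rw [Module.End.mem_maxGenEigenspace] at hx
    obtain ⟨k, hk⟩ := hx
    rw [zero_smul, sub_zero] at hk
    have : ∀ k x, (Matrix.toLin' M ^ k) x ∈ T → x ∈ T := by
      intro k
      induction k with
      | zero => exact fun x h => by simpa using h
      | succ k ih =>
        intro x h
        rw [pow_succ, Module.End.mul_apply] at h
        exact hstep x (ih _ h)
    exact this k x (hk ▸ T.zero_mem)
  have hfin := (LinearMap.finrank_maxGenEigenspace_eq (Matrix.toLin' M) 0).symm.trans_le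
    (Submodule.finrank_mono hle)
  rw [Matrix.charpoly_toLin'] at hfin
  have hTdim : Module.finrank K T ≤ n - B.rank := by
    let φ : T →ₗ[K] ({b // b ∉ I} → K) :=
      (LinearMap.funLeft K K fun b : {b // b ∉ I} => (.inr b.1 : Node n)).comp T.subtype
    have hφ : Function.Injective φ := by
      rw [← LinearMap.ker_eq_bot, LinearMap.ker_eq_bot']
      intro y hy
      obtain ⟨h1, h2⟩ := (hT y).1 y.2
      ext x
      rcases x with q | b
      · exact h1 q
      · by_cases hb : b ∈ I
        · obtain ⟨k, -, rfl⟩ := Finset.mem_map.1 hb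
          exact h2 k
        · exact congrFun hy ⟨b, hb⟩
    refine (LinearMap.finrank_le_finrank_of_injective hφ).trans_eq ?_
    rw [Module.finrank_fintype_fun_eq_card, Fintype.card_subtype_compl, Fintype.card_coe,
      Fintype.card_fin, Finset.card_map, Finset.card_univ, Fintype.card_fin]
  have := B.rank_le_width
  omega

end netMatrix

end BlackBox

/-! ### Hankel determinants of Krylov sequences -/

/-- The `k × k` Hankel determinant of the sequence `u ⬝ Mˢ⁺ⁱ v`. -/
def Matrix.hankelDet {R ι : Type*} [CommRing R] [Fintype ι] [DecidableEq ι] (M : Matrix ι ι R)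
    (u v : ι → R) (s k : ℕ) : R :=
  (Matrix.of fun i j : Fin k => u ⬝ᵥ (M ^ (s + (i + j : ℕ))).mulVec v).det

section Hankel

variable {ι : Type*} [Fintype ι] [DecidableEq ι]

theorem Matrix.map_hankelDet {R R' : Type*} [CommRing R] [CommRing R'] (φ : R →+* R')
    (M : Matrix ι ι R) (u v : ι → R) (s k : ℕ) :
    φ (M.hankelDet u v s k) = (M.map φ).hankelDet (φ ∘ u) (φ ∘ v) s k := by
  rw [Matrix.hankelDet, RingHom.map_det, Matrix.hankelDet]
  congr 1
  ext i j
  simp only [RingHom.mapMatrix_apply, Matrix.map_apply, Matrix.of_apply, RingHom.map_dotProduct]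
  congr 1
  funext x
  rw [← RingHom.mapMatrix_apply, ← map_pow, RingHom.mapMatrix_apply, ← RingHom.map_mulVec]
  rfl

variable {K : Type*} [Field K] (M : Matrix ι ι K)

theorem Matrix.hankelDet_eq_zero_of_rank_lt (u v : ι → K) {s k : ℕ} (hs : s ≠ 0)
    (h : M.rank < k) : M.hankelDet u v s k = 0 := by
  by_contra hne
  have hfac : (Matrix.of fun i j : Fin k => u ⬝ᵥ (M ^ (s + (i + j : ℕ))).mulVec v) =
      (Matrix.of fun (i : Fin k) x => Matrix.vecMul u (M ^ (s - 1 + i)) x) * M *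
        (Matrix.of fun x (j : Fin k) => (M ^ (j : ℕ)).mulVec v x) := by
    ext i j
    have h1 : M ^ (s + (i + j : ℕ)) = M ^ (s - 1 + i) * M * M ^ (j : ℕ) := by
      rw [← pow_succ, ← pow_add]
      congr 1
      omega
    rw [Matrix.of_apply, h1, ← Matrix.mulVec_mulVec, Matrix.dotProduct_mulVec,
      ← Matrix.vecMul_vecMul]
    rfl
  have hle := (Matrix.rank_mul_le_left _ (Matrix.of fun x (j : Fin k) =>
    (M ^ (j : ℕ)).mulVec v x)).trans
    (Matrix.rank_mul_le_right
      (Matrix.of fun (i : Fin k) x => Matrix.vecMul u (M ^ (s - 1 + i)) x) M)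
  rw [← hfac, Matrix.rank_of_det_ne_zero hne, Fintype.card_fin] at hle
  omega

theorem Matrix.linearIndependent_of_hankelDet_ne_zero {u v : ι → K} {s k : ℕ}
    (h : M.hankelDet u v s k ≠ 0) :
    LinearIndependent K fun i : Fin k => (M ^ (s + i : ℕ)).mulVec v := by
  rw [Fintype.linearIndependent_iff]
  intro g hg
  refine congrFun (Matrix.eq_zero_of_mulVec_eq_zero h ?_)
  funext i
  have h1 : (M ^ (i : ℕ)).mulVec (∑ j, g j • (M ^ (s + j : ℕ)).mulVec v) =
      ∑ j, g j • (M ^ (s + (i + j : ℕ))).mulVec v := by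
    rw [Matrix.mulVec_sum]
    refine Finset.sum_congr rfl fun j _ => ?_
    rw [Matrix.mulVec_smul, Matrix.mulVec_mulVec, ← pow_add]
    congr 3
    ring
  rw [hg, Matrix.mulVec_zero] at h1
  calc _ = u ⬝ᵥ ∑ j, g j • (M ^ (s + (i + j : ℕ))).mulVec v := by
        simp only [Matrix.mulVec, Matrix.of_apply, dotProduct_sum, dotProduct_smul, smul_eq_mul]
        rw [dotProduct]
        exact Finset.sum_congr rfl fun j _ => mul_comm _ _
    _ = 0 := by rw [← h1, dotProduct_zero]

/-- A functional dual to the last of the first `k` vectors makes the Hankel matrix vanish above the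
antidiagonal. -/
theorem Matrix.exists_hankelDet_ne_zero {v : ι → K} {s L : ℕ}
    (h : LinearIndependent K fun i : Fin L => (M ^ (s + i : ℕ)).mulVec v) {k : ℕ} (hk : k ≤ L) :
    ∃ u, M.hankelDet u v s k ≠ 0 := by
  rcases Nat.eq_zero_or_pos k with rfl | hk0
  · exact ⟨0, by simp [Matrix.hankelDet]⟩
  obtain ⟨φ, hφ⟩ : ∃ φ : (ι → K) →ₗ[K] K, ∀ i : Fin L,
      φ ((M ^ (s + i : ℕ)).mulVec v) = if (i : ℕ) = k - 1 then 1 else 0 := by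
    obtain ⟨φ, hφ⟩ := LinearMap.exists_extend
      ((Finsupp.lapply (⟨k - 1, by omega⟩ : Fin L) : (Fin L →₀ K) →ₗ[K] K).comp
        h.repr)
    refine ⟨φ, fun i => ?_⟩
    have h1 := LinearMap.congr_fun hφ ⟨_, Submodule.subset_span ⟨i, rfl⟩⟩
    simp only [LinearMap.comp_apply, Submodule.subtype_apply] at h1
    rw [h1, h.repr_eq_single i _ rfl, Finsupp.lapply_apply,
      Finsupp.single_apply]
    simp [Fin.ext_iff]
  refine ⟨fun x => φ (Pi.single x 1), ?_⟩
  have hu : ∀ y : ι → K, (fun x => φ (Pi.single x 1)) ⬝ᵥ y = φ y := by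
    intro y
    conv_rhs => rw [← LinearMap.sum_single_apply (fun _ : ι => K) y]
    rw [map_sum, dotProduct]
    refine Finset.sum_congr rfl fun x _ => ?_
    rw [mul_comm, ← smul_eq_mul, ← map_smul]
    congr 1
    ext z
    by_cases hz : z = x <;> simp [hz]
  have hentry : ∀ i j : Fin k, (i + j : ℕ) ≤ k - 1 →
      φ ((M ^ (s + (i + j : ℕ))).mulVec v) = if (i + j : ℕ) = k - 1 then 1 else 0 :=
    fun i j hij => hφ ⟨i + j, by omega⟩
  intro h0
  rw [Matrix.hankelDet] at h0
  have h1 := Matrix.det_permute (Fin.revPerm : Equiv.Perm (Fin k))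
    (Matrix.of fun i j : Fin k =>
      (fun x => φ (Pi.single x 1)) ⬝ᵥ (M ^ (s + (i + j : ℕ))).mulVec v)
  rw [h0, mul_zero, Matrix.det_of_isUpperTriangular] at h1
  · refine Finset.prod_ne_zero_iff.2 (fun i _ => ?_) h1
    have h2 : ((i.rev : ℕ) + i : ℕ) = k - 1 := by rw [Fin.val_rev]; omega
    simp only [Matrix.submatrix_apply, Matrix.of_apply, Fin.revPerm_apply, id_eq, hu]
    rw [hentry _ _ h2.le, if_pos h2]
    exact one_ne_zero
  · intro i j hij
    have hij' : (j : ℕ) < i := hij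
    have h2 : ((i.rev : ℕ) + j : ℕ) < k - 1 := by rw [Fin.val_rev]; omega
    simp only [Matrix.submatrix_apply, Matrix.of_apply, Fin.revPerm_apply, id_eq, hu]
    rw [hentry _ _ h2.le, if_neg h2.ne]

end Hankel

/-! ### Square-free factors of the characteristic polynomial -/

open Polynomial in
/-- Over an infinite field, some vector is annihilated only by the multiples of a given square-free
factor of the characteristic polynomial: the vectors for which this fails lie in finitely many
proper subspaces, one for each irreducible factor. -/
theorem Matrix.exists_forall_aeval_mulVec_eq_zero_dvd {F ι : Type*} [Field F] [Infinite F]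
    [Fintype ι] [DecidableEq ι] (M : Matrix ι ι F) {h : F[X]} (hsq : Squarefree h)
    (hdvd : h ∣ M.charpoly) : ∃ v, ∀ a : F[X], (aeval M a).mulVec v = 0 → h ∣ a := by
  classical
  have hh0 : h ≠ 0 := ne_zero_of_dvd_ne_zero M.charpoly_monic.ne_zero hdvd
  have hmin0 : minpoly F M ≠ 0 := minpoly.ne_zero M.isIntegral
  have hfac : ∀ g ∈ UniqueFactorizationMonoid.primeFactors h, ∃ m, minpoly F M = g * m := by
    intro g hg
    rw [UniqueFactorizationMonoid.mem_primeFactors] at hg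
    exact M.irreducible_dvd_minpoly_of_dvd_charpoly
      (UniqueFactorizationMonoid.irreducible_of_normalized_factor g hg)
      ((UniqueFactorizationMonoid.dvd_of_mem_normalizedFactors hg).trans hdvd)
  choose! m hm using hfac
  -- the subspace of the vectors that fail because of the factor `g`
  let s := (UniqueFactorizationMonoid.primeFactors h).image fun g =>
    LinearMap.ker (aeval M (m g)).mulVecLin
  have htop : ⊤ ∉ s := by
    intro htop
    obtain ⟨g, hg, hker⟩ := Finset.mem_image.1 htop
    have hzero : aeval M (m g) = 0 := by
      rw [LinearMap.ker_eq_top] at hker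
      exact Matrix.toLin'.injective (hker.trans (map_zero _).symm)
    have hm0 : m g ≠ 0 := fun h0 => hmin0 (by rw [hm g hg, h0, mul_zero])
    obtain ⟨c, hc⟩ := minpoly.dvd F M hzero
    have hunit : g * c = 1 := by
      refine mul_left_cancel₀ hm0 ?_
      calc m g * (g * c) = g * m g * c := by ring
        _ = minpoly F M * c := by rw [hm g hg]
        _ = m g * 1 := by rw [← hc, mul_one]
    rw [UniqueFactorizationMonoid.mem_primeFactors] at hg
    exact (UniqueFactorizationMonoid.irreducible_of_normalized_factor g hg).not_isUnit
      (IsUnit.of_mul_eq_one _ hunit)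
  obtain ⟨v, hv⟩ :=
    (Set.ne_univ_iff_exists_notMem _).1 (Subspace.biUnion_ne_univ_of_top_notMem htop)
  have hv' : ∀ g ∈ UniqueFactorizationMonoid.primeFactors h, (aeval M (m g)).mulVec v ≠ 0 := by
    intro g hg h0
    exact hv (Set.mem_biUnion (Finset.mem_coe.2 (Finset.mem_image_of_mem _ hg)) h0)
  refine ⟨v, fun a ha => ?_⟩
  rcases eq_or_ne a 0 with rfl | ha0
  · exact dvd_zero _
  refine (hsq.isRadical.dvd_radical hh0).trans
    ((UniqueFactorizationMonoid.radical_dvd_iff_primeFactors_subset ha0).2 fun g hg => ?_)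
  have hg' := UniqueFactorizationMonoid.mem_primeFactors.1 hg
  have hirr := UniqueFactorizationMonoid.irreducible_of_normalized_factor g hg'
  have hga : g ∣ a := by
    by_contra hga
    obtain ⟨x, y, hxy⟩ := (hirr.coprime_iff_not_dvd).2 hga
    apply hv' g hg
    have h1 : m g = x * minpoly F M + (y * m g) * a := by
      rw [hm g hg]
      linear_combination (- m g) * hxy
    rw [h1, map_add, map_mul, map_mul, minpoly.aeval, mul_zero, zero_add,
      ← Matrix.mulVec_mulVec, ha, Matrix.mulVec_zero]
  rw [UniqueFactorizationMonoid.mem_primeFactors]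
  obtain ⟨q, hq, hgq⟩ := UniqueFactorizationMonoid.exists_mem_normalizedFactors_of_dvd ha0 hirr hga
  have hn1 := UniqueFactorizationMonoid.normalize_normalized_factor g hg'
  have hn2 := UniqueFactorizationMonoid.normalize_normalized_factor q hq
  rwa [← hn1, normalize_eq_normalize hgq.dvd hgq.symm.dvd, hn2]

open MvPolynomial in
/-- A monic polynomial whose coefficients are multiaffine, and which specialises to a power of `X`,
has no square factor other than powers of `X`: such a factor does not involve the coefficients. -/
theorem MvPolynomial.dvd_X_of_irreducible_sq_dvd {σ K F : Type*} [Field K] [Field F]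
    [Algebra (MvPolynomial σ K) F] [IsFractionRing (MvPolynomial σ K) F]
    {p : Polynomial (MvPolynomial σ K)} (hp : p.Monic)
    (hdeg : ∀ e, degreeOf (some e) ((optionEquivLeft K σ).symm p) ≤ 1) {N : ℕ}
    (hspec : p.map constantCoeff = Polynomial.X ^ N) {g : Polynomial F} (hg : Irreducible g)
    (hdvd : g ^ 2 ∣ p.map (algebraMap _ F)) : g ∣ Polynomial.X := by
  have hinj : Function.Injective (algebraMap (MvPolynomial σ K) F) := IsFractionRing.injective _ _
  -- by Gauss's lemma, the factor has coefficients in the polynomial ring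
  obtain ⟨g₀, hg₀⟩ := IsIntegrallyClosed.eq_map_mul_C_of_dvd F hp
    ((Dvd.intro_left _ (pow_two g).symm).trans hdvd)
  have hlc : g.leadingCoeff ≠ 0 := Polynomial.leadingCoeff_ne_zero.2 hg.ne_zero
  have hass : Associated (g₀.map (algebraMap _ F)) g := by
    have : Associated (g₀.map (algebraMap _ F)) (g₀.map (algebraMap _ F) * _) :=
      (associated_mul_isUnit_right_iff (Polynomial.isUnit_C.2 hlc.isUnit)).2 (.refl _)
    rwa [hg₀] at this
  have hmonic : g₀.Monic := by
    apply Polynomial.monic_of_injective hinj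
    have := congrArg Polynomial.leadingCoeff hg₀
    rw [Polynomial.leadingCoeff_mul, Polynomial.leadingCoeff_C] at this
    exact mul_right_cancel₀ hlc (this.trans (one_mul _).symm)
  have hdvd₀ : g₀ ^ 2 ∣ p := by
    rw [← Polynomial.map_dvd_map _ hinj (hmonic.pow 2), Polynomial.map_pow]
    exact (pow_dvd_pow_of_dvd hass.dvd 2).trans hdvd
  obtain ⟨q, hq⟩ := hdvd₀
  set G := (optionEquivLeft K σ).symm g₀ with hG
  have hG0 : G ≠ 0 := by
    rw [hG, Ne, EmbeddingLike.map_eq_zero_iff]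
    exact hmonic.ne_zero
  have hdegG : ∀ e, degreeOf (some e) G = 0 := by
    intro e
    have h1 := hdeg e
    have hp0 : (optionEquivLeft K σ).symm p ≠ 0 := by
      rw [Ne, EmbeddingLike.map_eq_zero_iff]
      exact hp.ne_zero
    rw [hq, map_mul] at h1 hp0
    rw [degreeOf_mul_eq (left_ne_zero_of_mul hp0) (right_ne_zero_of_mul hp0), map_pow, pow_two,
      ← hG, degreeOf_mul_eq hG0 hG0] at h1
    omega
  have hconst : g₀ = (g₀.map constantCoeff).map C := by
    classical
    ext i m
    rw [Polynomial.coeff_map, Polynomial.coeff_map, coeff_C]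
    split_ifs with hm
    · rw [← hm, constantCoeff_eq]
    · by_contra hne
      apply hm
      have hmem : m ∈ ((optionEquivLeft K σ G).coeff i).support := by
        rw [hG, AlgEquiv.apply_symm_apply]
        exact MvPolynomial.mem_support_iff.2 hne
      rw [mem_support_coeff_optionEquivLeft] at hmem
      ext e
      have := monomial_le_degreeOf (some e) hmem
      rw [hdegG, Finsupp.optionElim_apply_some] at this
      simp only [Finsupp.coe_zero, Pi.zero_apply]
      omega
  have hspec₀ : g₀.map constantCoeff ∣ (Polynomial.X : Polynomial K) ^ N := by
    rw [← hspec, hq, Polynomial.map_mul, Polynomial.map_pow, pow_two, mul_assoc]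
    exact Dvd.intro _ rfl
  obtain ⟨j, -, hj⟩ := (dvd_prime_pow Polynomial.prime_X N).1 hspec₀
  have hXj : Associated g (Polynomial.X ^ j) := by
    refine hass.symm.trans ?_
    rw [hconst]
    have := (hj.map (Polynomial.mapRingHom (C : K →+* MvPolynomial σ K))).map
      (Polynomial.mapRingHom (algebraMap (MvPolynomial σ K) F))
    simpa using this
  exact hg.prime.dvd_of_dvd_pow hXj.dvd

/-! ### Generic networks -/

namespace BlackBox

variable {n : ℕ} {f : Node n → Fin 12 → Fin (3 * n)} {K : Type*} [Field K]
  (B : Matrix (Fin n) (Fin n) K)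

open MvPolynomial in
/-- The network with indeterminate weights. -/
noncomputable def genericNet (f : Node n → Fin 12 → Fin (3 * n)) :
    Matrix (Node n) (Node n) (MvPolynomial (Edge n) K) :=
  netMatrix f (B.map C) X

open MvPolynomial in
/-- Each weight occurs in a single row of the network. -/
theorem degreeOf_charpoly_genericNet_le (e : Edge n) :
    degreeOf (some e) ((optionEquivLeft K (Edge n)).symm (genericNet B f).charpoly) ≤ 1 := by
  have hsymmC : ∀ r : MvPolynomial (Edge n) K,
      (optionEquivLeft K (Edge n)).symm (Polynomial.C r) = rename some r := by
    intro r
    rw [AlgEquiv.symm_apply_eq]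
    induction r using MvPolynomial.induction_on with
    | C a => simp
    | add p q hp hq => rw [map_add, hp, hq, map_add, map_add]
    | mul_X p i hp => rw [map_mul, hp, map_mul, map_mul, rename_X, optionEquivLeft_X_some]
  have hentry : ∀ i j, degreeOf e (genericNet B f i j) ≤
      if i = .inl (Edge.head f e) then 1 else 0 := by
    intro i j
    rcases i with q | a
    · simp only [genericNet, netMatrix, Matrix.of_apply, Sum.elim_inl]
      refine (degreeOf_sum_le _ _ _).trans (Finset.sup_le fun e' _ => ?_)
      by_cases h1 : Edge.head f e' = q ∧ Edge.tail f e' = j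
      · rw [if_pos h1, degreeOf_X]
        by_cases h2 : e = e'
        · rw [h2, if_pos rfl, if_pos (by rw [h1.1])]
        · rw [if_neg h2]
          exact Nat.zero_le _
      · rw [if_neg h1, degreeOf_zero]
        exact Nat.zero_le _
    · rcases j with (j | j) | j <;> simp [genericNet, netMatrix, degreeOf_C]
  have hchar : ∀ i j, degreeOf (some e) ((optionEquivLeft K (Edge n)).symm
      ((genericNet B f).charmatrix i j)) ≤ if i = .inl (Edge.head f e) then 1 else 0 := by
    intro i j
    rw [Matrix.charmatrix_apply, map_sub, hsymmC]
    refine (degreeOf_sub_le _ _ _).trans (max_le ?_ ?_)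
    · rw [Matrix.diagonal_apply]
      split_ifs <;> simp [degreeOf_X]
    · rw [degreeOf_rename_of_injective (Option.some_injective _)]
      exact hentry i j
  rw [Matrix.charpoly, Matrix.det_apply, map_sum]
  refine (degreeOf_sum_le _ _ _).trans (Finset.sup_le fun σ _ => ?_)
  have hsign : ∀ p : MvPolynomial (Option (Edge n)) K,
      degreeOf (some e) ((Equiv.Perm.sign σ) • p) = degreeOf (some e) p := by
    intro p
    rcases Int.units_eq_one_or (Equiv.Perm.sign σ) with h | h <;> rw [h]
    · rw [one_smul]
    · rw [Units.neg_smul, one_smul, degreeOf_neg]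
  rw [Units.smul_def, map_zsmul, ← Units.smul_def, hsign, map_prod]
  refine (degreeOf_prod_le _ _ _).trans ?_
  refine (Finset.sum_le_sum fun i _ => hchar (σ i) i).trans_eq ?_
  rw [Equiv.sum_comp σ fun i => if i = Sum.inl (Edge.head f e) then 1 else 0]
  simp

open MvPolynomial in
theorem map_eval_genericNet (w : Edge n → K) :
    (genericNet B f).map (eval w) = netMatrix f B w := by
  rw [genericNet, map_netMatrix]
  congr 1
  · ext i j
    simp
  · funext e
    simp

open Polynomial in
/-- If the black box of a generic network has rank `r`, the Krylov space of some vector has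
dimension `4 n + r`, even after any number of steps: the characteristic polynomial has a square-free
factor of this degree that is prime to `X`. -/
theorem exists_linearIndependent_genericNet (hn : 0 < n) (hf : IsConcentrator f)
    (F : Type*) [Field F] [Algebra (MvPolynomial (Edge n) K) F]
    [IsFractionRing (MvPolynomial (Edge n) K) F] :
    ∃ v : Node n → F, ∀ s, LinearIndependent F fun i : Fin (4 * n + B.rank) =>
      (((genericNet B f).map (algebraMap _ F)) ^ (s + i : ℕ)).mulVec v := by
  have hinj : Function.Injective (algebraMap (MvPolynomial (Edge n) K) F) :=
    IsFractionRing.injective _ _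
  have : Nonempty (Edge n) := ⟨.inl (.inr ⟨0, hn⟩, 0)⟩
  have : Infinite F := Infinite.of_injective _ hinj
  set M := (genericNet B f).map (algebraMap _ F) with hM
  have hchar : M.charpoly = (genericNet B f).charpoly.map (algebraMap _ F) :=
    Matrix.charpoly_map _ _
  have hp0 : M.charpoly ≠ 0 := M.charpoly_monic.ne_zero
  -- remove from the characteristic polynomial its power of `X`
  set k := M.charpoly.rootMultiplicity 0 with hk
  have hfac := Polynomial.pow_mul_divByMonic_rootMultiplicity_eq M.charpoly 0
  rw [C_0, sub_zero, ← hk] at hfac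
  set h := M.charpoly /ₘ X ^ k with hh
  have hh0 : h ≠ 0 := fun h0 => hp0 (by rw [← hfac, h0, mul_zero])
  have hXh : ¬ X ∣ h := by
    intro hX
    have h1 : X ^ (k + 1) ∣ M.charpoly := by
      rw [← hfac, pow_succ]
      exact mul_dvd_mul_left _ hX
    have h2 := (Polynomial.le_rootMultiplicity_iff (a := 0) (n := k + 1) hp0).2 (by simpa using h1)
    omega
  have hsq : Squarefree h := by
    rw [squarefree_iff_irreducible_sq_not_dvd_of_ne_zero hh0]
    intro g hg hgh
    have h1 : g ^ 2 ∣ (genericNet B f).charpoly.map (algebraMap _ F) := by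
      rw [← hchar, ← hfac, pow_two]
      exact hgh.mul_left _
    have h2 : (genericNet B f).charpoly.map MvPolynomial.constantCoeff = X ^ (5 * n) := by
      rw [← Matrix.charpoly_map, ← charpoly_netMatrix_zero f B, genericNet, map_netMatrix]
      congr 2
      · ext i j
        simp
      · funext e
        simp
    have h3 := MvPolynomial.dvd_X_of_irreducible_sq_dvd (Matrix.charpoly_monic _)
      (degreeOf_charpoly_genericNet_le B) h2 hg h1
    exact hXh
      (((hg.associated_of_dvd irreducible_X h3).symm.dvd).trans ((Dvd.intro _ rfl).trans hgh))
  have hdeg : 4 * n + B.rank ≤ h.natDegree := by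
    obtain ⟨w, hw⟩ := exists_rootMultiplicity_charpoly_netMatrix_le f B hf
    have h1 : (X : F[X]) ^ k ∣ M.charpoly := by
      rw [← hfac]
      exact Dvd.intro _ rfl
    have h2 : (X : (MvPolynomial (Edge n) K)[X]) ^ k ∣ (genericNet B f).charpoly := by
      rw [← Polynomial.map_dvd_map _ hinj (monic_X_pow k), Polynomial.map_pow, map_X, ← hchar]
      exact h1
    have h3 : (X : K[X]) ^ k ∣ (netMatrix f B w).charpoly := by
      rw [← map_eval_genericNet, Matrix.charpoly_map]
      simpa using Polynomial.map_dvd (MvPolynomial.eval w) h2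
    have h4 := (Polynomial.le_rootMultiplicity_iff (a := 0) (n := k)
      (netMatrix f B w).charpoly_monic.ne_zero).2 (by simpa using h3)
    have h5 := congrArg natDegree hfac
    rw [natDegree_mul (pow_ne_zero _ X_ne_zero) hh0, natDegree_X_pow,
      Matrix.charpoly_natDegree_eq_dim] at h5
    simp only [Fintype.card_sum, Fintype.card_fin] at h5
    omega
  obtain ⟨v, hv⟩ := M.exists_forall_aeval_mulVec_eq_zero_dvd hsq (Dvd.intro_left _ hfac)
  refine ⟨v, fun s => ?_⟩
  rw [Fintype.linearIndependent_iff]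
  intro g hg
  set b : F[X] := ∑ i, C (g i) * X ^ (i : ℕ) with hb
  have h1 : (aeval M (X ^ s * b)).mulVec v = 0 := by
    rw [← hg, hb, Finset.mul_sum, map_sum, Matrix.sum_mulVec]
    refine Finset.sum_congr rfl fun i _ => ?_
    rw [show X ^ s * (C (g i) * X ^ (i : ℕ)) = C (g i) * X ^ (s + i : ℕ) by ring, ← smul_eq_C_mul,
      map_smul, Matrix.smul_mulVec, map_pow, aeval_X]
  have h2 : h ∣ b := by
    refine (IsCoprime.pow_right ?_).dvd_of_dvd_mul_left (hv _ h1)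
    exact ((irreducible_X.coprime_iff_not_dvd).2 hXh).symm
  have h3 : b = 0 := by
    refine eq_zero_of_dvd_of_degree_lt h2 ((degree_sum_fin_lt g).trans_le ?_)
    rw [degree_eq_natDegree hh0]
    exact_mod_cast hdeg
  intro i
  have h4 := congrArg (fun q => coeff q (i : ℕ)) h3
  simp only [hb, finsetSum_coeff, coeff_C_mul, coeff_X_pow, coeff_zero] at h4
  rwa [Finset.sum_eq_single i (fun j _ hj => by
    rw [if_neg (fun h => hj (Fin.ext h.symm)), mul_zero]) (by simp), if_pos rfl, mul_one] at h4

end BlackBox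

/-! ### The failure probability of the Hankel determinants -/

section SchwartzZippel

open Finset

/-- The Schwartz–Zippel lemma, for an arbitrary finite type of variables and without division. -/
theorem MvPolynomial.card_zeros_mul_card_le {K σ : Type*} [Field K] [DecidableEq K] [Fintype σ]
    [DecidableEq σ] {p : MvPolynomial σ K} (hp : p ≠ 0) (S : Finset K) {D : ℕ}
    (hD : p.totalDegree ≤ D) :
    #{x ∈ Fintype.piFinset fun _ : σ => S | eval x p = 0} * #S ≤ D * #S ^ Fintype.card σ := by
  rcases S.eq_empty_or_nonempty with rfl | hS
  · simp
  let e := Fintype.equivFin σ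
  have hp' : rename e p ≠ 0 := by
    rw [Ne, map_eq_zero_iff _ (rename_injective _ e.injective)]
    exact hp
  have h := schwartz_zippel_totalDegree hp' S
  have hcard : #{x ∈ Fintype.piFinset fun _ : σ => S | eval x p = 0} =
      #{x ∈ Fintype.piFinset fun _ : Fin (Fintype.card σ) => S | eval x (rename e p) = 0} := by
    refine Finset.card_bij (fun x _ => x ∘ e.symm) ?_ ?_ ?_
    · intro x hx
      simp only [mem_filter, Fintype.mem_piFinset, eval_rename, Function.comp_apply] at hx ⊢
      refine ⟨fun i => hx.1 _, ?_⟩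
      rw [show (x ∘ e.symm) ∘ e = x by ext; simp]
      exact hx.2
    · intro x _ y _ hxy
      exact e.symm.surjective.injective_comp_right hxy
    · intro y hy
      simp only [mem_filter, Fintype.mem_piFinset, eval_rename] at hy
      exact ⟨y ∘ e, by simpa using ⟨fun i => hy.1 _, hy.2⟩, by ext; simp⟩
  rw [← hcard] at h
  have hS0 : (0 : ℚ≥0) < #S := by exact_mod_cast hS.card_pos
  rw [div_le_div_iff₀ (by positivity) hS0] at h
  have h2 : #{x ∈ Fintype.piFinset fun _ : σ => S | eval x p = 0} * #S ≤
      (rename e p).totalDegree * #S ^ Fintype.card σ := by exact_mod_cast h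
  exact h2.trans (Nat.mul_le_mul_right _ ((totalDegree_rename_le _ _).trans hD))

end SchwartzZippel

section Degree

open MvPolynomial

variable {K σ ι : Type*} [Field K] [Fintype ι]

theorem MvPolynomial.totalDegree_mulVec_le {M : Matrix ι ι (MvPolynomial σ K)} {a b : ℕ}
    (hM : ∀ i j, (M i j).totalDegree ≤ a) {v : ι → MvPolynomial σ K}
    (hv : ∀ i, (v i).totalDegree ≤ b) (i : ι) : (M.mulVec v i).totalDegree ≤ a + b :=
  totalDegree_finsetSum_le fun j _ => (totalDegree_mul _ _).trans (add_le_add (hM i j) (hv j))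

theorem MvPolynomial.totalDegree_pow_mulVec_le [DecidableEq ι]
    {M : Matrix ι ι (MvPolynomial σ K)} {a b : ℕ}
    (hM : ∀ i j, (M i j).totalDegree ≤ a) {v : ι → MvPolynomial σ K}
    (hv : ∀ i, (v i).totalDegree ≤ b) (t : ℕ) (i : ι) :
    ((M ^ t).mulVec v i).totalDegree ≤ t * a + b := by
  induction t generalizing i with
  | zero => simpa using hv i
  | succ t ih =>
    rw [pow_succ', ← Matrix.mulVec_mulVec]
    exact (totalDegree_mulVec_le hM ih i).trans (by linarith)

theorem MvPolynomial.totalDegree_hankelDet_le [DecidableEq ι]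
    {M : Matrix ι ι (MvPolynomial σ K)} {a : ℕ}
    (hM : ∀ i j, (M i j).totalDegree ≤ a) {u v : ι → MvPolynomial σ K}
    (hu : ∀ i, (u i).totalDegree ≤ 1) (hv : ∀ i, (v i).totalDegree ≤ 1) (s k : ℕ) :
    (M.hankelDet u v s k).totalDegree ≤ k * ((s + 2 * k) * a + 2) := by
  rw [Matrix.hankelDet, Matrix.det_apply]
  refine totalDegree_finsetSum_le fun π _ => ?_
  refine (totalDegree_smul_le _ _).trans ?_
  refine (totalDegree_finsetProd _ _).trans ?_
  refine (Finset.sum_le_card_nsmul _ _ ((s + 2 * k) * a + 2) fun i _ => ?_).trans_eq (by simp)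
  rw [Matrix.of_apply]
  refine totalDegree_finsetSum_le fun x _ => ?_
  refine (totalDegree_mul _ _).trans ?_
  have h1 := totalDegree_pow_mulVec_le hM hv (s + ((π i : ℕ) + i)) x
  have h2 : (s + ((π i : ℕ) + i)) * a ≤ (s + 2 * k) * a :=
    Nat.mul_le_mul_right _ (by omega)
  linarith [hu x]

end Degree

namespace BlackBox

/-- The random elements of the rank algorithm: the weights of the edges, and the two vectors onto
which the powers of the matrix of the network are projected. -/
abbrev Var (n : ℕ) : Type := Edge n ⊕ (Node n ⊕ Node n)

variable {n : ℕ} (f : Node n → Fin 12 → Fin (3 * n)) {K : Type*} [Field K]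
  (B : Matrix (Fin n) (Fin n) K)

/-- The Hankel determinants of the projected powers of the matrix of the network. -/
def netHankel (x : Var n → K) (s k : ℕ) : K :=
  (netMatrix f B fun e => x (.inl e)).hankelDet (fun i => x (.inr (.inl i)))
    (fun i => x (.inr (.inr i))) s k

open MvPolynomial in
/-- `netHankel`, as a polynomial in the random elements. -/
noncomputable def netHankelPoly (s k : ℕ) : MvPolynomial (Var n) K :=
  (netMatrix f (B.map C) fun e => X (.inl e)).hankelDet (fun i => X (.inr (.inl i)))
    (fun i => X (.inr (.inr i))) s k

open MvPolynomial in
theorem eval_netHankelPoly (x : Var n → K) (s k : ℕ) :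
    eval x (netHankelPoly f B s k) = netHankel f B x s k := by
  rw [netHankelPoly, Matrix.map_hankelDet, map_netMatrix, netHankel]
  congr 1
  · congr 1
    · ext i j
      simp
    · funext e
      simp
  all_goals
    funext e
    simp

open MvPolynomial in
theorem totalDegree_netHankelPoly_le (s k : ℕ) :
    (netHankelPoly f B s k).totalDegree ≤ k * (s + 2 * k + 2) := by
  refine (totalDegree_hankelDet_le (a := 1) ?_ ?_ ?_ s k).trans_eq (by rw [mul_one])
  · intro i j
    rcases i with q | a
    · simp only [netMatrix, Matrix.of_apply, Sum.elim_inl]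
      refine totalDegree_finsetSum_le fun e _ => ?_
      split_ifs
      · rw [totalDegree_X]
      · simp
    · rcases j with (j | j) | j <;> simp [netMatrix]
  all_goals
    intro i
    rw [totalDegree_X]

open MvPolynomial in
theorem netHankelPoly_ne_zero (hn : 0 < n) (hf : IsConcentrator f) (s : ℕ) :
    netHankelPoly f B s (4 * n + B.rank) ≠ 0 := by
  let F := FractionRing (MvPolynomial (Edge n) K)
  obtain ⟨v, hv⟩ := exists_linearIndependent_genericNet B hn hf F
  obtain ⟨u, hu⟩ := Matrix.exists_hankelDet_ne_zero _ (hv s) le_rfl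
  let ι : K →+* F := (algebraMap (MvPolynomial (Edge n) K) F).comp C
  let φ : MvPolynomial (Var n) K →+* F := eval₂Hom ι
    (Sum.elim (fun e => algebraMap (MvPolynomial (Edge n) K) F (X e)) (Sum.elim u v))
  intro h0
  apply hu
  rw [← map_zero φ, ← h0, netHankelPoly, Matrix.map_hankelDet, map_netMatrix, genericNet,
    map_netMatrix]
  congr 1
  · congr 1
    · ext i j
      simp [φ, ι]
    · funext e
      simp [φ]
  all_goals
    funext e
    simp [φ]

open MvPolynomial in
/-- `netHankel` for fixed weights, as a polynomial in the two vectors. -/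
noncomputable def netHankelPolyOfWeights (w : Edge n → K) (s k : ℕ) :
    MvPolynomial (Node n ⊕ Node n) K :=
  ((netMatrix f B w).map C).hankelDet (fun i => X (.inl i)) (fun i => X (.inr i)) s k

open MvPolynomial in
theorem eval_netHankelPolyOfWeights (w : Edge n → K) (y : Node n ⊕ Node n → K) (s k : ℕ) :
    eval y (netHankelPolyOfWeights f B w s k) = netHankel f B (Sum.elim w y) s k := by
  rw [netHankelPolyOfWeights, Matrix.map_hankelDet, netHankel]
  congr 1
  · ext i j
    simp
  all_goals
    funext e
    simp

open MvPolynomial in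
theorem totalDegree_netHankelPolyOfWeights_le (w : Edge n → K) (s k : ℕ) :
    (netHankelPolyOfWeights f B w s k).totalDegree ≤ 2 * k := by
  refine (totalDegree_hankelDet_le (a := 0) ?_ ?_ ?_ s k).trans_eq (by ring)
  · intro i j
    simp
  all_goals
    intro i
    rw [totalDegree_X]

theorem netHankelPolyOfWeights_ne_zero {x : Var n → K} {s k L : ℕ}
    (hx : netHankel f B x s L ≠ 0) (hk : k ≤ L) :
    netHankelPolyOfWeights f B (fun e => x (.inl e)) s k ≠ 0 := by
  have h1 := Matrix.linearIndependent_of_hankelDet_ne_zero _ hx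
  obtain ⟨u, hu⟩ := Matrix.exists_hankelDet_ne_zero _ h1 hk
  intro h0
  have h2 := eval_netHankelPolyOfWeights f B (fun e => x (.inl e))
    (Sum.elim u fun i => x (.inr (.inr i))) s k
  rw [h0, map_zero] at h2
  exact hu h2.symm

open Finset in
/-- The leading Hankel determinants are all non-zero, except with probability `O(n² / |S|)`. For the
largest one, the probability is over the weights and the vectors; the others, of which there are
`O(n)`, then have degree `O(n)` in the vectors alone. -/
theorem card_netHankel_eq_zero_mul_card_le [DecidableEq K] (hn : 0 < n) (hf : IsConcentrator f)
    (S : Finset K) (s : ℕ) (hs : s ≤ 2) :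
    #{x ∈ Fintype.piFinset fun _ : Var n => S |
      ∃ k ≤ 4 * n + B.rank, netHankel f B x s k = 0} * #S ≤
        120 * n ^ 2 * #S ^ Fintype.card (Var n) := by
  set L := 4 * n + B.rank with hL
  have hLn : L ≤ 5 * n := by have := B.rank_le_width; omega
  have hfirst : #{x ∈ Fintype.piFinset fun _ : Var n => S | netHankel f B x s L = 0} * #S ≤
      (5 * n * (12 * n + 2)) * #S ^ Fintype.card (Var n) := by
    have := MvPolynomial.card_zeros_mul_card_le (netHankelPoly_ne_zero f B hn hf s) S
      (D := 5 * n * (12 * n + 2)) ((totalDegree_netHankelPoly_le f B s _).trans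
        (Nat.mul_le_mul hLn (by omega)))
    simpa only [eval_netHankelPoly] using this
  -- for fixed weights, the smaller determinants are polynomials in the two vectors
  have hother : ∀ k < L, #{x ∈ Fintype.piFinset fun _ : Var n => S |
      netHankel f B x s k = 0 ∧ netHankel f B x s L ≠ 0} * #S ≤
        (10 * n) * #S ^ Fintype.card (Var n) := by
    intro k hk
    rw [Finset.card_eq_sum_card_fiberwise (f := fun x e => x (.inl e))
      (t := Fintype.piFinset fun _ : Edge n => S), Finset.sum_mul]
    · refine (Finset.sum_le_card_nsmul _ _
        ((10 * n) * #S ^ Fintype.card (Node n ⊕ Node n)) fun w _ => ?_).trans_eq ?_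
      · rcases Finset.eq_empty_or_nonempty {x ∈ {x ∈ Fintype.piFinset fun _ : Var n => S |
          netHankel f B x s k = 0 ∧ netHankel f B x s L ≠ 0} | (fun e => x (.inl e)) = w}
          with h0 | ⟨x₀, hx₀⟩
        · rw [h0]
          simp
        · simp only [mem_filter] at hx₀
          obtain ⟨⟨-, -, hx₁⟩, rfl⟩ := hx₀
          refine le_trans (Nat.mul_le_mul_right _ ?_) (MvPolynomial.card_zeros_mul_card_le
            (netHankelPolyOfWeights_ne_zero f B hx₁ hk.le) S (D := 10 * n)
            ((totalDegree_netHankelPolyOfWeights_le f B _ s k).trans (by omega)))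
          refine Finset.card_le_card_of_injOn (fun x y => x (.inr y)) ?_ ?_
          · intro x hx
            simp only [coe_filter, mem_filter, Set.mem_ofPred_eq, Fintype.mem_piFinset] at hx ⊢
            refine ⟨fun i => hx.1.1 _, ?_⟩
            rw [eval_netHankelPolyOfWeights, ← hx.2]
            exact hx.1.2.1
          · intro x hx y hy hxy
            simp only [coe_filter, mem_filter, Set.mem_ofPred_eq] at hx hy
            funext i
            rcases i with i | i
            · exact congrFun (hx.2.trans hy.2.symm) i
            · exact congrFun hxy i
      · rw [Fintype.card_piFinset, Finset.prod_const, Finset.card_univ, smul_eq_mul,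
          Fintype.card_sum (α := Edge n), pow_add]
        ring
    · intro x hx
      simp only [coe_filter, Set.mem_ofPred_eq, Fintype.mem_piFinset, mem_coe] at hx ⊢
      exact fun e => hx.1 _
  calc _ ≤ (#{x ∈ Fintype.piFinset fun _ : Var n => S | netHankel f B x s L = 0} +
        ∑ k ∈ range L, #{x ∈ Fintype.piFinset fun _ : Var n => S |
          netHankel f B x s k = 0 ∧ netHankel f B x s L ≠ 0}) * #S := by
        refine Nat.mul_le_mul_right _ ?_
        refine le_trans (Finset.card_le_card ?_) ((card_union_le _ _).trans
          (Nat.add_le_add_left card_biUnion_le _))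
        intro x hx
        simp only [mem_filter, mem_union, mem_biUnion, mem_range] at hx ⊢
        obtain ⟨hxS, k, hk, hxk⟩ := hx
        by_cases hxL : netHankel f B x s L = 0
        · exact .inl ⟨hxS, hxL⟩
        · exact .inr ⟨k, lt_of_le_of_ne hk (by rintro rfl; exact hxL hxk), hxS, hxk, hxL⟩
    _ ≤ (5 * n * (12 * n + 2)) * #S ^ Fintype.card (Var n) +
        ∑ k ∈ range L, (10 * n) * #S ^ Fintype.card (Var n) := by
        rw [add_mul, Finset.sum_mul]
        exact add_le_add hfirst (Finset.sum_le_sum fun k hk => hother k (mem_range.1 hk))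
    _ = (5 * n * (12 * n + 2) + L * (10 * n)) * #S ^ Fintype.card (Var n) := by
        rw [sum_const, card_range, smul_eq_mul]
        ring
    _ ≤ _ := Nat.mul_le_mul_right _ (by nlinarith)

end BlackBox

/-! ### Fraction-free continued fractions -/

section HankelRow

open Polynomial

variable {K : Type*} [Field K]

/-- The rows of a fraction-free continued fraction expansion of the sequence `h`. When the Hankel
determinants of `h` and of its shift are non-zero up to size `L`, and that of `h` of size `L + 1` is
zero, the row `2 L` is the first whose leading entry is zero. -/
def hankelRow (h : ℕ → K) : ℕ → ℕ → K
  | 0 => h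
  | 1 => fun i => h (i + 1)
  | k + 2 => fun i =>
      hankelRow h k 0 * hankelRow h (k + 1) (i + 1) - hankelRow h (k + 1) 0 * hankelRow h k (i + 1)

/-- The linear functional on polynomials with moments `h`. -/
noncomputable def momentFunctional (h : ℕ → K) : K[X] →ₗ[K] K :=
  Polynomial.lsum fun i => LinearMap.toSpanSingleton K K (h i)

theorem momentFunctional_monomial (h : ℕ → K) (i : ℕ) (a : K) :
    momentFunctional h (monomial i a) = a * h i := by
  simp [momentFunctional]

theorem momentFunctional_X_pow_mul (h : ℕ → K) {p : K[X]} {k : ℕ} (hp : p.natDegree < k) (l : ℕ) :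
    momentFunctional h (X ^ l * p) = ∑ i : Fin k, h (l + i) * p.coeff i := by
  rw [Fin.sum_univ_eq_sum_range fun i => h (l + i) * p.coeff i]
  conv_lhs => rw [p.as_sum_range' k hp]
  rw [Finset.mul_sum, map_sum]
  refine Finset.sum_congr rfl fun i _ => ?_
  rw [X_pow_mul_monomial, momentFunctional_monomial, mul_comm, add_comm]

/-- The polynomials orthogonal with respect to the functionals with moments `h i` and `h (i + 1)`,
up to scalars. -/
noncomputable def orthogonalPolys (h : ℕ → K) : ℕ → K[X] × K[X]
  | 0 => (1, 1)
  | j + 1 =>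
      let s := C (hankelRow h (2 * j) 0) * (X * (orthogonalPolys h j).2) -
        C (hankelRow h (2 * j + 1) 0) * (orthogonalPolys h j).1
      (s, C (hankelRow h (2 * j + 1) 0) * s -
        C (hankelRow h (2 * j + 2) 0) * (orthogonalPolys h j).2)

theorem momentFunctional_C_mul (h : ℕ → K) (a : K) (p : K[X]) :
    momentFunctional h (C a * p) = a * momentFunctional h p := by
  rw [← smul_eq_C_mul, map_smul, smul_eq_mul]

theorem momentFunctional_X_pow_mul_orthogonalPolys_succ_fst (h : ℕ → K) (j l : ℕ) :
    momentFunctional h (X ^ l * (orthogonalPolys h (j + 1)).1) =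
      hankelRow h (2 * j) 0 * momentFunctional h (X ^ (l + 1) * (orthogonalPolys h j).2) -
        hankelRow h (2 * j + 1) 0 * momentFunctional h (X ^ l * (orthogonalPolys h j).1) := by
  rw [← momentFunctional_C_mul, ← momentFunctional_C_mul, ← map_sub]
  congr 1
  simp only [orthogonalPolys]
  ring

theorem momentFunctional_X_pow_mul_orthogonalPolys_succ_snd (h : ℕ → K) (j l : ℕ) :
    momentFunctional h (X ^ l * (orthogonalPolys h (j + 1)).2) =
      hankelRow h (2 * j + 1) 0 * momentFunctional h (X ^ l * (orthogonalPolys h (j + 1)).1) -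
        hankelRow h (2 * j + 2) 0 * momentFunctional h (X ^ l * (orthogonalPolys h j).2) := by
  rw [← momentFunctional_C_mul, ← momentFunctional_C_mul, ← map_sub]
  congr 1
  simp only [orthogonalPolys]
  ring

/-- The rows are the moments of the orthogonal polynomials. -/
theorem hankelRow_eq_momentFunctional (h : ℕ → K) (j : ℕ) :
    (∀ i, hankelRow h (2 * j) i = momentFunctional h (X ^ (i + j) * (orthogonalPolys h j).1)) ∧
      ∀ i, hankelRow h (2 * j + 1) i =
        momentFunctional h (X ^ (i + j + 1) * (orthogonalPolys h j).2) := by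
  induction j with
  | zero =>
    constructor <;> intro i <;>
      simp [orthogonalPolys, hankelRow, X_pow_eq_monomial, momentFunctional_monomial]
  | succ j ih =>
    have h1 : ∀ i, hankelRow h (2 * (j + 1)) i =
        momentFunctional h (X ^ (i + (j + 1)) * (orthogonalPolys h (j + 1)).1) := by
      intro i
      rw [momentFunctional_X_pow_mul_orthogonalPolys_succ_fst,
        show i + (j + 1) + 1 = i + 1 + j + 1 by ring, show i + (j + 1) = i + 1 + j by ring,
        ← ih.1, ← ih.2]
      rfl
    refine ⟨h1, fun i => ?_⟩
    rw [momentFunctional_X_pow_mul_orthogonalPolys_succ_snd,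
      show i + (j + 1) + 1 = (i + 1) + (j + 1) by ring, ← h1,
      show (i + 1) + (j + 1) = (i + 1) + j + 1 by ring, ← ih.2]
    rfl

theorem momentFunctional_orthogonal (h : ℕ → K) (j : ℕ) :
    (∀ l < j, momentFunctional h (X ^ l * (orthogonalPolys h j).1) = 0) ∧
      ∀ l < j, momentFunctional h (X ^ (l + 1) * (orthogonalPolys h j).2) = 0 := by
  induction j with
  | zero => exact ⟨fun l hl => absurd hl (by omega), fun l hl => absurd hl (by omega)⟩
  | succ j ih =>
    have hrow := hankelRow_eq_momentFunctional h j
    have h1 : ∀ l < j + 1, momentFunctional h (X ^ l * (orthogonalPolys h (j + 1)).1) = 0 := by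
      intro l hl
      rw [momentFunctional_X_pow_mul_orthogonalPolys_succ_fst]
      rcases Nat.lt_succ_iff_lt_or_eq.1 hl with hl | rfl
      · rw [ih.1 l hl, ih.2 l hl]
        ring
      · have e1 := hrow.1 0
        have e2 := hrow.2 0
        rw [zero_add] at e1 e2
        rw [← e1, ← e2]
        ring
    refine ⟨h1, fun l hl => ?_⟩
    rw [momentFunctional_X_pow_mul_orthogonalPolys_succ_snd]
    rcases Nat.lt_succ_iff_lt_or_eq.1 hl with hl | rfl
    · rw [h1 (l + 1) (by omega), ih.2 l hl]
      ring
    · have e1 := (hankelRow_eq_momentFunctional h (l + 1)).1 0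
      have e2 := hrow.2 0
      rw [zero_add] at e1 e2
      rw [← e1, ← e2]
      rw [mul_comm]
      exact sub_self _

theorem natDegree_orthogonalPolys_le (h : ℕ → K) (j : ℕ) :
    (orthogonalPolys h j).1.natDegree ≤ j ∧ (orthogonalPolys h j).2.natDegree ≤ j := by
  induction j with
  | zero => simp [orthogonalPolys]
  | succ j ih =>
    have h1 : (orthogonalPolys h (j + 1)).1.natDegree ≤ j + 1 := by
      refine (natDegree_sub_le _ _).trans (max_le ?_ ?_)
      · refine (natDegree_C_mul_le _ _).trans (natDegree_mul_le.trans ?_)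
        rw [natDegree_X]
        omega
      · exact (natDegree_C_mul_le _ _).trans (by omega)
    refine ⟨h1, (natDegree_sub_le _ _).trans (max_le ?_ ?_)⟩
    · exact (natDegree_C_mul_le _ _).trans h1
    · exact (natDegree_C_mul_le _ _).trans (by omega)

theorem coeff_orthogonalPolys_ne_zero (h : ℕ → K) (j : ℕ)
    (hrow : ∀ i < 2 * j, hankelRow h i 0 ≠ 0) :
    (orthogonalPolys h j).1.coeff j ≠ 0 ∧ (orthogonalPolys h j).2.coeff j ≠ 0 := by
  induction j with
  | zero => simp [orthogonalPolys]
  | succ j ih =>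
    have ih := ih fun i hi => hrow i (by omega)
    have hdeg := natDegree_orthogonalPolys_le h j
    have h1 : (orthogonalPolys h (j + 1)).1.coeff (j + 1) =
        hankelRow h (2 * j) 0 * (orthogonalPolys h j).2.coeff j := by
      simp only [orthogonalPolys, coeff_sub, coeff_C_mul, coeff_X_mul]
      rw [coeff_eq_zero_of_natDegree_lt (p := (orthogonalPolys h j).1) (by omega)]
      ring
    have h2 : (orthogonalPolys h (j + 1)).2.coeff (j + 1) =
        hankelRow h (2 * j + 1) 0 * (orthogonalPolys h (j + 1)).1.coeff (j + 1) := by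
      simp only [orthogonalPolys, coeff_sub, coeff_C_mul]
      rw [coeff_eq_zero_of_natDegree_lt (p := (orthogonalPolys h j).2) (by omega)]
      ring
    rw [h2, h1]
    exact ⟨mul_ne_zero (hrow _ (by omega)) ih.2,
      mul_ne_zero (hrow _ (by omega)) (mul_ne_zero (hrow _ (by omega)) ih.2)⟩

theorem det_hankel_eq_zero_of_momentFunctional (h : ℕ → K) {p : K[X]} {j : ℕ} (t : ℕ)
    (hdeg : p.natDegree ≤ j) (hp : p.coeff j ≠ 0)
    (horth : ∀ l < j + 1, momentFunctional h (X ^ (l + t) * p) = 0) :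
    (Matrix.of fun i k : Fin (j + 1) => h (t + (i + k : ℕ))).det = 0 := by
  rw [← Matrix.exists_mulVec_eq_zero_iff]
  refine ⟨fun i => p.coeff i, fun h0 => hp (congrFun h0 (Fin.last j)), ?_⟩
  funext l
  have h1 := horth l l.2
  rw [momentFunctional_X_pow_mul h (Nat.lt_succ_of_le hdeg)] at h1
  rw [Pi.zero_apply, ← h1]
  simp only [Matrix.mulVec, dotProduct, Matrix.of_apply]
  refine Finset.sum_congr rfl fun i _ => ?_
  congr 2
  ring

/-- As long as the Hankel determinants do not vanish, the leading entries of the rows do not. -/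
theorem hankelRow_zero_ne_zero (h : ℕ → K) {L : ℕ}
    (hdet : ∀ t < 2, ∀ k ≤ L, (Matrix.of fun i j : Fin k => h (t + (i + j : ℕ))).det ≠ 0)
    {i : ℕ} (hi : i < 2 * L) : hankelRow h i 0 ≠ 0 := by
  induction i using Nat.strong_induction_on with
  | _ i ih =>
    intro h0
    obtain ⟨j, rfl | rfl⟩ := i.even_or_odd'
    all_goals
      have hlead := coeff_orthogonalPolys_ne_zero h j fun i hi => ih i (by omega) (by omega)
      have hdeg := natDegree_orthogonalPolys_le h j
      have horth := momentFunctional_orthogonal h j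
      have hrow := hankelRow_eq_momentFunctional h j
    · refine hdet 0 (by omega) (j + 1) (by omega)
        (det_hankel_eq_zero_of_momentFunctional h 0 hdeg.1 hlead.1 fun l hl => ?_)
      rcases Nat.lt_succ_iff_lt_or_eq.1 hl with hl | rfl
      · exact horth.1 l hl
      · rw [← h0, hrow.1, zero_add, add_zero]
    · refine hdet 1 (by omega) (j + 1) (by omega)
        (det_hankel_eq_zero_of_momentFunctional h 1 hdeg.2 hlead.2 fun l hl => ?_)
      rcases Nat.lt_succ_iff_lt_or_eq.1 hl with hl | rfl
      · exact horth.2 l hl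
      · rw [← h0, hrow.2, zero_add]

/-- A polynomial in the kernel of the first singular Hankel matrix is orthogonal to the orthogonal
polynomial of the same degree, whose square therefore has moment zero. -/
theorem hankelRow_zero_eq_zero (h : ℕ → K) {L : ℕ}
    (hrow : ∀ i < 2 * L, hankelRow h i 0 ≠ 0)
    (hdet : (Matrix.of fun i j : Fin (L + 1) => h (i + j : ℕ)).det = 0) :
    hankelRow h (2 * L) 0 = 0 := by
  obtain ⟨g, hg0, hg⟩ := Matrix.exists_mulVec_eq_zero_iff.2 hdet
  set G : K[X] := ∑ i, C (g i) * X ^ (i : ℕ) with hG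
  have hcoeff : ∀ i : Fin (L + 1), G.coeff i = g i := by
    intro i
    simp only [hG, finsetSum_coeff, coeff_C_mul, coeff_X_pow]
    rw [Finset.sum_eq_single i (fun j _ hj => by
      rw [if_neg (fun h => hj (Fin.ext h.symm)), mul_zero]) (by simp), if_pos rfl, mul_one]
  have hG0 : G ≠ 0 := by
    intro h0
    apply hg0
    funext i
    rw [← hcoeff, h0, coeff_zero, Pi.zero_apply]
  have hGdeg : G.natDegree < L + 1 :=
    (natDegree_lt_iff_degree_lt hG0).2 (hG ▸ degree_sum_fin_lt g)
  have hGorth : ∀ l < L + 1, momentFunctional h (X ^ l * G) = 0 := by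
    intro l hl
    rw [momentFunctional_X_pow_mul h hGdeg,
      ← Pi.zero_apply (M := fun _ => K) (⟨l, hl⟩ : Fin (L + 1)), ← hg]
    simp only [Matrix.mulVec, dotProduct, Matrix.of_apply]
    exact Finset.sum_congr rfl fun i _ => by rw [hcoeff]
  set t := G.natDegree with ht
  set s := (orthogonalPolys h t).1
  have hsdeg : s.natDegree < L + 1 := (natDegree_orthogonalPolys_le h t).1.trans_lt hGdeg
  have h1 : momentFunctional h (s * G) = 0 := by
    conv_lhs => rw [s.as_sum_range' (L + 1) hsdeg]
    rw [Finset.sum_mul, map_sum]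
    refine Finset.sum_eq_zero fun i hi => ?_
    rw [← C_mul_X_pow_eq_monomial, mul_assoc, momentFunctional_C_mul,
      hGorth i (Finset.mem_range.1 hi), mul_zero]
  have h2 : momentFunctional h (s * G) = G.leadingCoeff * hankelRow h (2 * t) 0 := by
    conv_lhs => rw [mul_comm, G.as_sum_range]
    rw [Finset.sum_mul, map_sum, Finset.sum_range_succ, Finset.sum_eq_zero, zero_add,
      ← C_mul_X_pow_eq_monomial, mul_assoc, momentFunctional_C_mul,
      (hankelRow_eq_momentFunctional h t).1 0, zero_add]
    · rfl
    · intro i hi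
      rw [← C_mul_X_pow_eq_monomial, mul_assoc, momentFunctional_C_mul,
        (momentFunctional_orthogonal h t).1 i (Finset.mem_range.1 hi), mul_zero]
  have h3 : hankelRow h (2 * t) 0 = 0 :=
    (mul_eq_zero.1 (h2.symm.trans h1)).resolve_left (leadingCoeff_ne_zero.2 hG0)
  rcases Nat.lt_succ_iff_lt_or_eq.1 hGdeg with hlt | heq
  · exact absurd h3 (hrow _ (by omega))
  · rwa [← heq]

end HankelRow

/-! ### Deterministic runs and Horner's rule -/

namespace BlackBox

theorem Outcome.charge_charge {K : Type*} {α : Type} (a b a' b' : ℕ) (o : Outcome K α) :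
    (o.charge a b).charge a' b' = o.charge (a + a') (b + b') := by
  simp [Outcome.charge, add_assoc]

theorem Outcome.charge_zero {K : Type*} {α : Type} (o : Outcome K α) : o.charge 0 0 = o := by
  simp [Outcome.charge]

namespace Prog

variable {n : ℕ} {α β γ : Type}

theorem bind_assoc (p : Prog n α) (f : α → Prog n β) (g : β → Prog n γ) :
    (p.bind f).bind g = p.bind fun a => (f a).bind g := by
  induction p with
  | ret a => rfl
  | zero k ih | one k ih | arith o a b k ih | isZero a k ih | random k ih | blackBox v k ih =>
    simp only [bind, ih]

theorem withBlackBox_bind (box : (Fin n → ℕ) → Prog n (Fin n → ℕ)) (p : Prog n α)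
    (f : α → Prog n β) :
    (p.bind f).withBlackBox box = (p.withBlackBox box).bind fun a => (f a).withBlackBox box := by
  induction p with
  | ret a => rfl
  | zero k ih | one k ih | arith o a b k ih | isZero a k ih | random k ih =>
    simp only [bind, withBlackBox, ih]
  | blackBox v k ih => simp only [bind, withBlackBox, ih, bind_assoc]

theorem withBlackBox_sequence (box : (Fin n → ℕ) → Prog n (Fin n → ℕ)) (m : ℕ)
    (f : Fin m → Prog n ℕ) :
    (sequence m f).withBlackBox box = sequence m fun i => (f i).withBlackBox box := by
  induction m with
  | zero => rfl
  | succ m ih => simp only [sequence, withBlackBox_bind, ih, withBlackBox]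

end Prog

section run

variable {K : Type*} [Field K] {n : ℕ} {α β : Type} {A : Matrix (Fin n) (Fin n) K}
  {S : Finset K} {hS : S.Nonempty}

theorem run_bind (p : Prog n α) (f : α → Prog n β) (mem : List K) :
    (p.bind f).run A S hS mem = (p.run A S hS mem).bind fun o =>
      ((f o.value).run A S hS o.mem).map (Outcome.charge o.ops o.calls) := by
  have key : ∀ (a b : ℕ) (q : PMF (Outcome K α)),
      (q.bind fun o => ((f o.value).run A S hS o.mem).map (Outcome.charge o.ops o.calls)).map
        (Outcome.charge a b) = (q.map (Outcome.charge a b)).bind fun o =>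
          ((f o.value).run A S hS o.mem).map (Outcome.charge o.ops o.calls) := by
    intro a b q
    rw [PMF.map_bind, PMF.bind_map]
    congr 1
    funext o
    rw [PMF.map_comp]
    congr 1
    funext o'
    rw [Function.comp_apply, Outcome.charge_charge]
    rfl
  induction p generalizing mem with
  | ret a =>
    simp only [Prog.bind, Prog.run, PMF.pure_bind]
    rw [show (Outcome.charge 0 0 : Outcome K β → Outcome K β) = id from
      funext Outcome.charge_zero, PMF.map_id]
  | zero k ih | one k ih | arith o a b k ih | isZero a k ih | blackBox v k ih =>
    simp only [Prog.bind, Prog.run, ih, key]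
  | random k ih => simp only [Prog.bind, Prog.run, ih, key, PMF.bind_bind]

/-- The program `p`, run from the memory `mem`, is deterministic, only appends to the memory, takes
at most `a` operations and exactly `b` calls of the black box, and its result satisfies `Q`. -/
def Spec (A : Matrix (Fin n) (Fin n) K) (S : Finset K) (hS : S.Nonempty) (p : Prog n α)
    (mem : List K) (a b : ℕ) (Q : α → List K → Prop) : Prop :=
  ∃ o, p.run A S hS mem = PMF.pure o ∧ mem <+: o.mem ∧ o.ops ≤ a ∧ o.calls = b ∧ Q o.value o.mem

variable {mem : List K} {a b a' b' : ℕ} {Q : α → List K → Prop}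

theorem Spec.ret {x : α} (h : Q x mem) : Spec A S hS (.ret x) mem 0 0 Q :=
  ⟨_, rfl, List.prefix_rfl, le_rfl, rfl, h⟩

theorem Spec.mono {p : Prog n α} {Q' : α → List K → Prop} (h : Spec A S hS p mem a b Q)
    (ha : a ≤ a') (hb : b = b') (hQ : ∀ x mem', mem <+: mem' → Q x mem' → Q' x mem') :
    Spec A S hS p mem a' b' Q' := by
  obtain ⟨o, h1, h2, h3, h4, h5⟩ := h
  exact ⟨o, h1, h2, h3.trans ha, h4.trans hb, hQ _ _ h2 h5⟩

theorem Spec.bind {p : Prog n α} {f : α → Prog n β} {Q' : β → List K → Prop}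
    (hp : Spec A S hS p mem a b Q)
    (hf : ∀ x mem', mem <+: mem' → Q x mem' → Spec A S hS (f x) mem' a' b' Q') :
    Spec A S hS (p.bind f) mem (a + a') (b + b') Q' := by
  obtain ⟨o, h1, h2, h3, h4, h5⟩ := hp
  obtain ⟨o', h1', h2', h3', h4', h5'⟩ := hf _ _ h2 h5
  refine ⟨o'.charge o.ops o.calls, ?_, h2.trans h2', ?_, ?_, h5'⟩
  · rw [run_bind, h1, PMF.pure_bind, h1', PMF.pure_map]
  · simp only [Outcome.charge]
    omega
  · simp only [Outcome.charge]
    omega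

theorem Spec.zero {k : ℕ → Prog n α} (h : Spec A S hS (k mem.length) (mem ++ [0]) a b Q) :
    Spec A S hS (.zero k) mem (a + 1) b Q := by
  obtain ⟨o, h1, h2, h3, h4, h5⟩ := h
  exact ⟨o.charge 1 0, by rw [Prog.run, h1, PMF.pure_map], (List.prefix_append _ _).trans h2,
    Nat.add_le_add_right h3 1, h4, h5⟩

theorem Spec.arith {op : ArithOp} {i j : ℕ} {k : ℕ → Prog n α}
    (h : Spec A S hS (k mem.length) (mem ++ [op.eval (read mem i) (read mem j)]) a b Q) :
    Spec A S hS (.arith op i j k) mem (a + 1) b Q := by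
  obtain ⟨o, h1, h2, h3, h4, h5⟩ := h
  exact ⟨o.charge 1 0, by rw [Prog.run, h1, PMF.pure_map], (List.prefix_append _ _).trans h2,
    Nat.add_le_add_right h3 1, h4, h5⟩

open Classical in
theorem Spec.isZero {i : ℕ} {k : Bool → Prog n α}
    (h : Spec A S hS (k (decide (read mem i = 0))) mem a b Q) :
    Spec A S hS (.isZero i k) mem (a + 1) b Q := by
  obtain ⟨o, h1, h2, h3, h4, h5⟩ := h
  exact ⟨o.charge 1 0, by rw [Prog.run, h1, PMF.pure_map], h2, Nat.add_le_add_right h3 1, h4, h5⟩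

theorem Spec.blackBox {v : Fin n → ℕ} {k : (Fin n → ℕ) → Prog n α}
    (h : Spec A S hS (k fun i => mem.length + i)
      (mem ++ List.ofFn (A.mulVec fun i => read mem (v i))) a b Q) :
    Spec A S hS (.blackBox v k) mem a (b + 1) Q := by
  obtain ⟨o, h1, h2, h3, h4, h5⟩ := h
  exact ⟨o.charge 0 1, by rw [Prog.run, h1, PMF.pure_map], (List.prefix_append _ _).trans h2,
    h3, by rw [← h4]; rfl, h5⟩

/-- The cell `a` of the memory holds the field element `x`. -/
def Holds (mem : List K) (a : ℕ) (x : K) : Prop :=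
  a < mem.length ∧ read mem a = x

theorem Holds.mono {mem mem' : List K} {a : ℕ} {x : K} (h : Holds mem a x) (hp : mem <+: mem') :
    Holds mem' a x := by
  obtain ⟨l, rfl⟩ := hp
  obtain ⟨h1, h2⟩ := h
  refine ⟨by rw [List.length_append]; omega, ?_⟩
  rw [← h2, read, read, List.getD_append _ _ _ _ h1]

theorem holds_append_singleton (mem : List K) (x : K) : Holds (mem ++ [x]) mem.length x := by
  refine ⟨by simp, ?_⟩
  rw [read, List.getD_append_right _ _ _ _ le_rfl]
  simp

theorem holds_append_ofFn (mem : List K) {m : ℕ} (x : Fin m → K) (i : Fin m) :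
    Holds (mem ++ List.ofFn x) (mem.length + i) (x i) := by
  refine ⟨by simp, ?_⟩
  rw [read, List.getD_append_right _ _ _ _ (by omega)]
  simp

theorem Spec.sequence {m c : ℕ} {f : Fin m → Prog n ℕ} {x : Fin m → K}
    (h : ∀ i mem', mem <+: mem' → Spec A S hS (f i) mem' c 0 fun a mem'' => Holds mem'' a (x i)) :
    Spec A S hS (Prog.sequence m f) mem (m * c) 0 fun a mem' => ∀ i, Holds mem' (a i) (x i) := by
  induction m generalizing mem with
  | zero => exact (Spec.ret (by intro i; exact i.elim0)).mono (Nat.zero_le _) rfl fun _ _ _ h => h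
  | succ m ih =>
    refine ((h 0 mem List.prefix_rfl).bind (a' := m * c) (b' := 0) fun a₀ mem₁ hm₁ h₁ => ?_).mono
      (by rw [add_mul, one_mul, add_comm]) rfl fun _ _ _ h => h
    refine ((ih fun i mem' hmem' => h i.succ mem' (hm₁.trans hmem')).bind (a' := 0) (b' := 0)
      fun as mem₂ hm₂ h₂ => ?_).mono le_rfl rfl fun _ _ _ h => h
    refine Spec.ret fun i => ?_
    cases i using Fin.cases with
    | zero => exact h₁.mono hm₂
    | succ i => exact h₂ i

end run

section horner

variable {K : Type*} [Field K] {n : ℕ} {A : Matrix (Fin n) (Fin n) K}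
  {S : Finset K} {hS : S.Nonempty} {mem : List K}

theorem Spec.horner {d : ℕ} {c : ℕ → ℕ} {v : Fin n → ℕ} {p : ℕ → K} {x : Fin n → K}
    (hc : ∀ i ≤ d, Holds mem (c i) (p i)) (hv : ∀ i, Holds mem (v i) (x i)) :
    Spec A S hS (BlackBox.horner d c v) mem (n + d * (2 * n)) d fun a mem' => ∀ i,
      Holds mem' (a i) ((∑ j ∈ Finset.range (d + 1), p j • A ^ j).mulVec x i) := by
  induction d generalizing c p with
  | zero =>
    refine (Spec.sequence (c := 1) (x := fun i => p 0 * x i) fun i mem' hmem' => ?_).mono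
      (by omega) rfl fun a mem' _ h i => ?_
    · refine Spec.arith (Spec.ret ?_)
      rw [((hc 0 le_rfl).mono hmem').2, ((hv i).mono hmem').2]
      exact holds_append_singleton _ _
    · simpa [Matrix.smul_mulVec] using h i
  | succ d ih =>
    refine ((ih (c := fun i => c (i + 1)) (p := fun i => p (i + 1))
      fun i hi => hc (i + 1) (by omega)).bind (a' := n * 2) (b' := 1)
        fun w mem₁ hm₁ hw => ?_).mono (le_of_eq (by ring)) rfl fun _ _ _ h => h
    refine Spec.blackBox (b := 0) ?_
    have hm₂ := List.prefix_append mem₁ (List.ofFn (A.mulVec fun i => read mem₁ (w i)))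
    refine (Spec.sequence (c := 2) (x := fun i => p 0 * x i +
      A.mulVec (fun i => read mem₁ (w i)) i) fun i mem' hmem' => ?_).mono
      le_rfl rfl fun a mem' _ h i => ?_
    · have hm := (hm₁.trans hm₂).trans hmem'
      refine Spec.arith (Spec.arith (Spec.ret ?_))
      rw [((hc 0 (by omega)).mono hm).2, ((hv i).mono hm).2, (holds_append_singleton _ _).2,
        (((holds_append_ofFn mem₁ _ i).mono hmem').mono (List.prefix_append _ _)).2]
      exact holds_append_singleton _ _
    · convert h i using 1
      have hwr : (fun i => read mem₁ (w i)) =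
          (∑ j ∈ Finset.range (d + 1), p (j + 1) • A ^ j).mulVec x :=
        funext fun i => (hw i).2
      rw [hwr, Matrix.mulVec_mulVec, Finset.mul_sum, Finset.sum_range_succ']
      simp only [Matrix.mul_smul, ← pow_succ', pow_zero, Matrix.add_mulVec, Matrix.smul_mulVec,
        Matrix.one_mulVec, Pi.add_apply, Pi.smul_apply, smul_eq_mul]
      rw [add_comm]

open Polynomial in
theorem holds_coeffs {P : K[X]} (hmem : coeffs P <+: mem) {i : ℕ} (hi : i ≤ P.natDegree) :
    Holds mem i (P.coeff i) := by
  refine Holds.mono ⟨by simp [coeffs]; omega, ?_⟩ hmem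
  rw [read, coeffs, List.getD_eq_getElem _ _ (by simp; omega), List.getElem_ofFn]

open Polynomial in
theorem Spec.powerBox {P : K[X]} (hmem : coeffs P <+: mem) {e : ℕ} {v : Fin n → ℕ}
    {x : Fin n → K} (hv : ∀ i, Holds mem (v i) (x i)) :
    Spec A S hS (BlackBox.powerBox n P.natDegree e v) mem (e * (n + P.natDegree * (2 * n)))
      (e * P.natDegree) fun a mem' => ∀ i, Holds mem' (a i) ((aeval A P ^ e).mulVec x i) := by
  induction e with
  | zero =>
    refine (Spec.ret ?_).mono (Nat.zero_le _) (by ring) fun _ _ _ h => h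
    simpa using hv
  | succ e ih =>
    refine (ih.bind fun w mem₁ hm₁ hw => Spec.horner (d := P.natDegree) (p := P.coeff)
      (fun i hi => holds_coeffs (hmem.trans hm₁) hi) hw).mono (le_of_eq (by ring)) (by ring)
      fun a mem' _ h i => ?_
    have hi := h i
    rwa [← aeval_eq_sum_range, Matrix.mulVec_mulVec, ← pow_succ'] at hi

end horner

end BlackBox

/-! ### The programs of the rank algorithm -/

namespace BlackBox

section programs

variable {n : ℕ} (box : (Fin n → ℕ) → Prog n (Fin n → ℕ)) (f : Node n → Fin 12 → Fin (3 * n))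

/-- Add to the cells `y q` the contributions of a list of edges. -/
def accumulate (w : Edge n → ℕ) (x : Node n → ℕ) :
    List (Edge n) → (Inner n → ℕ) → Prog n (Inner n → ℕ)
  | [], y => .ret y
  | e :: l, y => .arith .mul (w e) (x (Edge.tail f e)) fun t => .arith .add (y (Edge.head f e)) t
      fun t' => accumulate w x l (Function.update y (Edge.head f e) t')

/-- Multiply the matrix of the network by a vector. The cell `z` contains zero. -/
noncomputable def netStep (z : ℕ) (w : Edge n → ℕ) (x : Node n → ℕ) : Prog n (Node n → ℕ) :=
  (accumulate f w x Finset.univ.toList fun _ => z).bind fun y =>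
    (box fun c => x (.inl (.inr c))).bind fun b => .ret (Sum.elim y b)

/-- Add to the cell `s` the products of the entries of two vectors. -/
def dotProg (u y : Node n → ℕ) : List (Node n) → ℕ → Prog n ℕ
  | [], s => .ret s
  | i :: l, s => .arith .mul (u i) (y i) fun t => .arith .add s t fun s' => dotProg u y l s'

/-- The first `t` terms of the sequence `u ⬝ Mⁱ⁺¹ x`, where `M` is the matrix of the network. -/
noncomputable def krylov (z : ℕ) (w : Edge n → ℕ) (u : Node n → ℕ) :
    (t : ℕ) → (Node n → ℕ) → Prog n (Fin t → ℕ)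
  | 0, _ => .ret Fin.elim0
  | t + 1, x => (netStep box f z w x).bind fun x' =>
      (dotProg u x' Finset.univ.toList z).bind fun h =>
        (krylov z w u t x').bind fun hs => .ret (Fin.cons h hs)

/-- Look for the first row of the continued fraction expansion whose leading entry is zero. The
cells `a` and `b` contain the rows with numbers `k` and `k + 1`. -/
def scan : (m k : ℕ) → (Fin (m + 1) → ℕ) → (Fin m → ℕ) → Prog n ℕ
  | 0, k, a, _ => .isZero (a 0) fun t => .ret (if t then k else k + 1)
  | m + 1, k, a, b => .isZero (a 0) fun t => if t then .ret k else
      (Prog.sequence m fun i => .arith .mul (a 0) (b i.succ) fun p =>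
        .arith .mul (b 0) (a i.castSucc.succ) fun q => .arith .sub p q .ret).bind fun c =>
          scan m (k + 1) b c

/-- The black-box rank algorithm, for the subroutine `box`: draw the weights of the network and two
vectors, compute the sequence, and find the first row of its expansion with a zero leading entry.
The network has `5 n` nodes, so `10 n` terms of the sequence determine the rank of its
matrix. -/
noncomputable def rankProg : Prog n ℕ :=
  (Prog.sequence (Fintype.card (Var n)) fun _ => .random .ret).bind fun a => .zero fun z =>
    (krylov box f z (fun e => a (Fintype.equivFin (Var n) (.inl e)))
      (fun i => a (Fintype.equivFin (Var n) (.inr (.inl i)))) (10 * n - 1 + 1)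
      fun i => a (Fintype.equivFin (Var n) (.inr (.inr i)))).bind fun h =>
        (scan (10 * n - 1) 0 h fun i => h i.succ).bind fun k => .ret (k / 2 - 4 * n)

end programs

section withBlackBox

variable {n : ℕ} (box box' : (Fin n → ℕ) → Prog n (Fin n → ℕ))
  (f : Node n → Fin 12 → Fin (3 * n))

theorem withBlackBox_accumulate (w : Edge n → ℕ) (x : Node n → ℕ) (l : List (Edge n))
    (y : Inner n → ℕ) :
    (accumulate f w x l y).withBlackBox box = accumulate f w x l y := by
  induction l generalizing y with
  | nil => rfl
  | cons e l ih => simp only [accumulate, Prog.withBlackBox, ih]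

theorem withBlackBox_dotProg (u y : Node n → ℕ) (l : List (Node n)) (s : ℕ) :
    (dotProg u y l s).withBlackBox box = dotProg u y l s := by
  induction l generalizing s with
  | nil => rfl
  | cons e l ih => simp only [dotProg, Prog.withBlackBox, ih]

theorem withBlackBox_krylov (z : ℕ) (w : Edge n → ℕ) (u : Node n → ℕ) (t : ℕ)
    (x : Node n → ℕ) :
    (krylov box' f z w u t x).withBlackBox box =
      krylov (fun v => (box' v).withBlackBox box) f z w u t x := by
  induction t generalizing x with
  | zero => rfl
  | succ t ih =>
    simp only [krylov, netStep, Prog.withBlackBox_bind, withBlackBox_accumulate,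
      withBlackBox_dotProg, ih, Prog.withBlackBox]

theorem withBlackBox_scan (m k : ℕ) (a : Fin (m + 1) → ℕ) (b : Fin m → ℕ) :
    (scan (n := n) m k a b).withBlackBox box = scan m k a b := by
  induction m generalizing k with
  | zero => rfl
  | succ m ih =>
    simp only [scan, Prog.withBlackBox]
    congr 1
    funext t
    split_ifs
    · rfl
    · simp only [Prog.withBlackBox_bind, Prog.withBlackBox_sequence, Prog.withBlackBox, ih]

theorem withBlackBox_rankProg :
    (rankProg box' f).withBlackBox box = rankProg (fun v => (box' v).withBlackBox box) f := by
  simp only [rankProg, Prog.withBlackBox_bind, Prog.withBlackBox_sequence, Prog.withBlackBox,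
    withBlackBox_krylov, withBlackBox_scan]

end withBlackBox

section Spec

variable {K : Type*} [Field K] {n : ℕ} {A : Matrix (Fin n) (Fin n) K}
  {S : Finset K} {hS : S.Nonempty} {mem : List K}
  {box : (Fin n → ℕ) → Prog n (Fin n → ℕ)} {f : Node n → Fin 12 → Fin (3 * n)}

/-- In every memory that extends `mem₀`, the subroutine `box` multiplies the matrix `B` by a vector,
with at most `co` operations and exactly `cc` calls of the black box. -/
def IsBox (A : Matrix (Fin n) (Fin n) K) (S : Finset K) (hS : S.Nonempty)
    (box : (Fin n → ℕ) → Prog n (Fin n → ℕ)) (mem₀ : List K) (B : Matrix (Fin n) (Fin n) K)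
    (co cc : ℕ) : Prop :=
  ∀ mem, mem₀ <+: mem → ∀ (v : Fin n → ℕ) (x : Fin n → K), (∀ i, Holds mem (v i) (x i)) →
    Spec A S hS (box v) mem co cc fun a mem' => ∀ i, Holds mem' (a i) (B.mulVec x i)

theorem Spec.accumulate {w : Edge n → ℕ} {W : Edge n → K} (hw : ∀ e, Holds mem (w e) (W e))
    {x : Node n → ℕ} {X : Node n → K} (hx : ∀ i, Holds mem (x i) (X i)) (l : List (Edge n))
    {y : Inner n → ℕ} {Y : Inner n → K} (hy : ∀ q, Holds mem (y q) (Y q)) :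
    Spec A S hS (BlackBox.accumulate f w x l y) mem (2 * l.length) 0 fun a mem' => ∀ q,
      Holds mem' (a q) (Y q + (l.map fun e =>
        if Edge.head f e = q then W e * X (Edge.tail f e) else 0).sum) := by
  induction l generalizing mem y Y with
  | nil => exact Spec.ret (by simpa using hy)
  | cons e l ih =>
    have hm₁ := List.prefix_append mem [W e * X (Edge.tail f e)]
    have hm₂ := List.prefix_append (mem ++ [W e * X (Edge.tail f e)])
      [Y (Edge.head f e) + W e * X (Edge.tail f e)]
    have hm := hm₁.trans hm₂
    refine (Spec.arith (a := 2 * l.length + 1) (Spec.arith ?_)).mono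
      (le_of_eq (by simp; ring)) rfl fun _ _ _ h => h
    simp only [ArithOp.eval, (hw e).2, (hx _).2, ((hy _).mono hm₁).2,
      (holds_append_singleton mem (W e * X (Edge.tail f e))).2]
    refine (ih (Y := Function.update Y (Edge.head f e)
        (Y (Edge.head f e) + W e * X (Edge.tail f e)))
      (fun e => (hw e).mono hm) (fun i => (hx i).mono hm) ?_).mono le_rfl rfl ?_
    · intro q
      by_cases hq : q = Edge.head f e
      · subst hq
        rw [Function.update_self, Function.update_self]
        exact holds_append_singleton _ _
      · rw [Function.update_of_ne hq, Function.update_of_ne hq]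
        exact (hy q).mono hm
    · intro a mem' _ h q
      convert h q using 1
      rw [List.map_cons, List.sum_cons, ← add_assoc]
      congr 1
      by_cases hq : q = Edge.head f e
      · subst hq
        rw [Function.update_self, if_pos rfl]
      · rw [Function.update_of_ne hq, if_neg (fun h => hq h.symm), add_zero]

theorem Spec.netStep {B : Matrix (Fin n) (Fin n) K} {mem₀ : List K} {co cc : ℕ}
    (hbox : IsBox A S hS box mem₀ B co cc) (hmem : mem₀ <+: mem) {z : ℕ} (hz : Holds mem z 0)
    {w : Edge n → ℕ} {W : Edge n → K} (hw : ∀ e, Holds mem (w e) (W e))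
    {x : Node n → ℕ} {X : Node n → K} (hx : ∀ i, Holds mem (x i) (X i)) :
    Spec A S hS (BlackBox.netStep box f z w x) mem (216 * n + co) cc fun a mem' => ∀ i,
      Holds mem' (a i) ((netMatrix f B W).mulVec X i) := by
  refine ((Spec.accumulate hw hx _ (Y := fun _ => 0) fun _ => hz).bind (a' := co + 0)
    (b' := cc + 0) fun y mem₁ hm₁ hy =>
    (hbox mem₁ (hmem.trans hm₁) _ (fun c => X (.inl (.inr c))) fun c => (hx _).mono hm₁).bind
      fun b mem₂ hm₂ hb => Spec.ret (Q := fun (a : Node n → ℕ) mem' => ∀ i,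
        Holds mem' (a i) ((netMatrix f B W).mulVec X i)) ?_).mono ?_ (by ring) fun _ _ _ h => h
  · rintro (q | c)
    · rw [netMatrix_mulVec_inl]
      have := (hy q).mono hm₂
      rwa [zero_add, Finset.sum_map_toList] at this
    · rw [netMatrix_mulVec_inr]
      exact hb c
  · rw [Finset.length_toList, Finset.card_univ]
    simp only [Fintype.card_sum, Fintype.card_prod, Fintype.card_fin]
    omega

theorem Spec.dotProg {u y : Node n → ℕ} {U Y : Node n → K} (hu : ∀ i, Holds mem (u i) (U i))
    (hy : ∀ i, Holds mem (y i) (Y i)) (l : List (Node n)) {s : ℕ} {c : K} (hs : Holds mem s c) :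
    Spec A S hS (BlackBox.dotProg u y l s) mem (2 * l.length) 0 fun a mem' =>
      Holds mem' a (c + (l.map fun i => U i * Y i).sum) := by
  induction l generalizing mem s c with
  | nil => exact Spec.ret (by simpa using hs)
  | cons i l ih =>
    have hm₁ := List.prefix_append mem [U i * Y i]
    have hm₂ := List.prefix_append (mem ++ [U i * Y i]) [c + U i * Y i]
    have hm := hm₁.trans hm₂
    refine (Spec.arith (a := 2 * l.length + 1) (Spec.arith ?_)).mono
      (le_of_eq (by simp; ring)) rfl fun _ _ _ h => h
    simp only [ArithOp.eval, (hu i).2, (hy i).2, (hs.mono hm₁).2,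
      (holds_append_singleton mem (U i * Y i)).2]
    refine (ih (fun i => (hu i).mono hm) (fun i => (hy i).mono hm)
      (holds_append_singleton _ _)).mono le_rfl rfl fun a mem' _ h => ?_
    rwa [List.map_cons, List.sum_cons, ← add_assoc]

theorem Spec.krylov {B : Matrix (Fin n) (Fin n) K} {mem₀ : List K} {co cc : ℕ}
    (hbox : IsBox A S hS box mem₀ B co cc) (hmem : mem₀ <+: mem) {z : ℕ} (hz : Holds mem z 0)
    {w : Edge n → ℕ} {W : Edge n → K} (hw : ∀ e, Holds mem (w e) (W e))
    {u : Node n → ℕ} {U : Node n → K} (hu : ∀ i, Holds mem (u i) (U i)) (t : ℕ)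
    {x : Node n → ℕ} {X : Node n → K} (hx : ∀ i, Holds mem (x i) (X i)) :
    Spec A S hS (BlackBox.krylov box f z w u t x) mem (t * (226 * n + co)) (t * cc)
      fun a mem' => ∀ i : Fin t,
        Holds mem' (a i) (U ⬝ᵥ (netMatrix f B W ^ (1 + i : ℕ)).mulVec X) := by
  induction t generalizing mem x X with
  | zero => exact (Spec.ret fun i => i.elim0).mono (Nat.zero_le _) (by ring) fun _ _ _ h => h
  | succ t ih =>
    refine ((Spec.netStep hbox hmem hz hw hx).bind (a' := 10 * n + (t * (226 * n + co) + 0))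
      (b' := 0 + (t * cc + 0)) fun x' mem₁ hm₁ hx' =>
      ((Spec.dotProg (fun i => (hu i).mono hm₁) hx' Finset.univ.toList (hz.mono hm₁)).mono ?_ rfl
        fun _ _ _ h => h).bind fun h mem₂ hm₂ hh =>
        (ih (hmem.trans (hm₁.trans hm₂)) (hz.mono (hm₁.trans hm₂))
          (fun e => (hw e).mono (hm₁.trans hm₂)) (fun i => (hu i).mono (hm₁.trans hm₂))
          (fun i => (hx' i).mono hm₂)).bind fun hs mem₃ hm₃ hhs =>
            Spec.ret (Q := fun (a : Fin (t + 1) → ℕ) mem' => ∀ i,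
              Holds mem' (a i) (U ⬝ᵥ (netMatrix f B W ^ (1 + i : ℕ)).mulVec X)) ?_).mono
                (le_of_eq (by ring)) (by ring) fun _ _ _ h => h
    · rw [Finset.length_toList, Finset.card_univ]
      simp only [Fintype.card_sum, Fintype.card_fin]
      omega
    · intro i
      cases i using Fin.cases with
      | zero =>
        have := hh.mono hm₃
        rw [zero_add, Finset.sum_map_toList] at this
        simpa [dotProduct] using this
      | succ i =>
        have := hhs i
        rw [Matrix.mulVec_mulVec, ← pow_succ] at this
        rw [Fin.val_succ, ← add_assoc]
        convert this using 5
        rfl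

open Classical in
/-- The result of `scan`. -/
noncomputable def scanValue (h : ℕ → K) : (m k : ℕ) → ℕ
  | 0, k => if hankelRow h k 0 = 0 then k else k + 1
  | m + 1, k => if hankelRow h k 0 = 0 then k else scanValue h m (k + 1)

theorem scanValue_eq {h : ℕ → K} {m k N : ℕ} (hk : k ≤ N) (hN : N ≤ m + k + 1)
    (hlt : ∀ i < N, hankelRow h i 0 ≠ 0) (heq : hankelRow h N 0 = 0) : scanValue h m k = N := by
  induction m generalizing k with
  | zero =>
    rcases hk.eq_or_lt with rfl | hk
    · rw [scanValue, if_pos heq]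
    · rw [scanValue, if_neg (hlt k hk)]
      omega
  | succ m ih =>
    rcases hk.eq_or_lt with rfl | hk
    · rw [scanValue, if_pos heq]
    · rw [scanValue, if_neg (hlt k hk)]
      exact ih hk (by omega)

theorem Spec.scan {h : ℕ → K} {m k : ℕ} {a : Fin (m + 1) → ℕ} {b : Fin m → ℕ}
    (ha : ∀ i, Holds mem (a i) (hankelRow h k i))
    (hb : ∀ i, Holds mem (b i) (hankelRow h (k + 1) i)) :
    Spec A S hS (BlackBox.scan m k a b) mem ((m + 1) * (3 * m + 1)) 0
      fun r _ => r = scanValue h m k := by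
  induction m generalizing mem k with
  | zero =>
    refine Spec.isZero ((Spec.ret ?_).mono le_rfl rfl fun _ _ _ h => h)
    rw [(ha 0).2, scanValue]
    by_cases h0 : hankelRow h k 0 = 0 <;> simp [h0]
  | succ m ih =>
    refine (Spec.isZero (a := m * 3 + (m + 1) * (3 * m + 1)) ?_).mono (by nlinarith) rfl
      fun _ _ _ h => h
    rw [(ha 0).2]
    by_cases h0 : hankelRow h k 0 = 0
    · simp only [Fin.val_zero, h0, decide_true, if_true]
      exact (Spec.ret (by rw [scanValue, if_pos h0])).mono (Nat.zero_le _) rfl fun _ _ _ h => h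
    · simp only [Fin.val_zero, h0, decide_false, Bool.false_eq_true, if_false]
      refine (Spec.sequence (x := fun i : Fin m => hankelRow h (k + 2) i)
        fun i mem' hm => ?_).bind (a' := (m + 1) * (3 * m + 1)) (b' := 0) fun c mem₁ hm₁ hc => ?_
      · refine Spec.arith (Spec.arith (Spec.arith (Spec.ret ?_)))
        simp only [ArithOp.eval]
        rw [((ha 0).mono hm).2, ((hb i.succ).mono hm).2,
          ((hb 0).mono (hm.trans (List.prefix_append _ _))).2,
          ((ha i.castSucc.succ).mono (hm.trans (List.prefix_append _ _))).2,
          (holds_append_singleton _ _).2,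
          ((holds_append_singleton mem' _).mono (List.prefix_append _ _)).2]
        exact holds_append_singleton _ _
      · refine (ih (fun i => (hb i).mono hm₁) hc).mono le_rfl rfl fun r _ _ hr => ?_
        rw [hr, scanValue, if_neg h0]

end Spec

end BlackBox

/-! ### The law of the rank algorithm -/

namespace BlackBox

section random

variable {K : Type*}

/-- The uniform distribution on the functions from `Fin m` to `S`. -/
noncomputable def uniformFun (S : Finset K) (hS : S.Nonempty) : (m : ℕ) → PMF (Fin m → K)
  | 0 => PMF.pure Fin.elim0
  | m + 1 => (PMF.uniformOfFinset S hS).bind fun x => (uniformFun S hS m).map (Fin.cons x)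

open Classical in
theorem uniformFun_apply (S : Finset K) (hS : S.Nonempty) (m : ℕ) (x : Fin m → K) :
    uniformFun S hS m x = if x ∈ Fintype.piFinset fun _ => S then ((S.card : ENNReal)⁻¹) ^ m
      else 0 := by
  induction m with
  | zero =>
    rw [uniformFun, PMF.pure_apply, if_pos (Subsingleton.elim _ _),
      if_pos (Fintype.mem_piFinset.2 fun i => i.elim0), pow_zero]
  | succ m ih =>
    have hmap : ∀ y, (uniformFun S hS m).map (Fin.cons y) x =
        if x 0 = y then uniformFun S hS m (Fin.tail x) else 0 := by
      intro y
      rw [PMF.map_apply]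
      by_cases hy : x 0 = y
      · rw [tsum_eq_single (Fin.tail x), if_pos hy, if_pos]
        · rw [← hy, Fin.cons_self_tail]
        · intro z hz
          rw [if_neg]
          rintro rfl
          exact hz (by rw [Fin.tail_cons])
      · rw [if_neg hy]
        refine ENNReal.tsum_eq_zero.2 fun z => if_neg ?_
        rintro rfl
        exact hy (by rw [Fin.cons_zero])
    rw [uniformFun, PMF.bind_apply, tsum_eq_single (x 0), hmap, if_pos rfl, ih,
      PMF.uniformOfFinset_apply]
    · simp only [Fintype.mem_piFinset, Fin.forall_fin_succ (P := fun i => x i ∈ S), Fin.tail]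
      by_cases h0 : x 0 ∈ S
      · by_cases h1 : ∀ i : Fin m, x i.succ ∈ S
        · simp only [h0, h1, implies_true, and_self, if_true, pow_succ']
        · simp [h0, h1]
      · simp [h0]
    · intro y hy
      rw [hmap, if_neg (fun h => hy h.symm), mul_zero]

open Finset in
theorem toOuterMeasure_uniformFun [DecidableEq K] (S : Finset K) (hS : S.Nonempty) (m : ℕ)
    (p : (Fin m → K) → Prop) [DecidablePred p] :
    (uniformFun S hS m).toOuterMeasure {x | p x} =
      (#{x ∈ Fintype.piFinset fun _ : Fin m => S | p x} : ENNReal) / (#S : ENNReal) ^ m := by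
  rw [PMF.toOuterMeasure_apply,
    tsum_eq_sum (s := {x ∈ Fintype.piFinset fun _ : Fin m => S | p x})]
  · rw [Finset.sum_congr rfl (g := fun _ => ((#S : ENNReal)⁻¹) ^ m), sum_const, nsmul_eq_mul,
      ENNReal.div_eq_inv_mul, mul_comm, ENNReal.inv_pow]
    intro x hx
    rw [mem_filter] at hx
    rw [Set.indicator_of_mem (by exact hx.2), uniformFun_apply]
    convert if_pos hx.1
  · intro x hx
    rw [mem_filter, not_and] at hx
    by_cases hp : p x
    · rw [Set.indicator_of_mem (by exact hp), uniformFun_apply]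
      convert if_neg fun h => hx h hp
    · rw [Set.indicator_of_notMem (by exact hp)]

variable [Field K] {n : ℕ} {A : Matrix (Fin n) (Fin n) K} {S : Finset K} {hS : S.Nonempty}

theorem run_sequence_random (m : ℕ) (mem : List K) :
    (Prog.sequence m fun _ => .random .ret).run A S hS mem = (uniformFun S hS m).map fun x =>
      ⟨fun i => mem.length + i, mem ++ List.ofFn x, m, 0⟩ := by
  induction m generalizing mem with
  | zero =>
    rw [Prog.sequence, Prog.run, uniformFun, PMF.pure_map]
    congr 2
    · exact Subsingleton.elim _ _
    · simp
  | succ m ih =>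
    simp only [Prog.sequence, Prog.bind, Prog.run, run_bind, ih, uniformFun, PMF.map_bind,
      PMF.bind_map]
    congr 1
    funext x
    rw [PMF.map_comp]
    simp only [Function.comp_def, PMF.pure_map]
    rw [← PMF.bind_pure_comp]
    congr 1
    funext a
    simp only [Function.comp_apply, Outcome.charge, List.append_assoc]
    congr 2
    · funext i
      cases i using Fin.cases with
      | zero => simp
      | succ i =>
        simp only [Fin.cons_succ, List.length_append, List.length_singleton, Fin.val_succ]
        ring
    · rw [List.ofFn_succ]
      simp
    · ring

end random

section rankProg

variable {K : Type*} [Field K] {n : ℕ} (f : Node n → Fin 12 → Fin (3 * n))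
  (B : Matrix (Fin n) (Fin n) K)

/-- The sequence that the rank algorithm computes from the random elements `x`. -/
def netSequence (x : Var n → K) (i : ℕ) : K :=
  (fun i => x (.inr (.inl i))) ⬝ᵥ
    (netMatrix f B (fun e => x (.inl e)) ^ (1 + i)).mulVec fun i => x (.inr (.inr i))

/-- The result of the rank algorithm for the random elements `x`. -/
noncomputable def rankValue (x : Var n → K) : ℕ :=
  scanValue (netSequence f B x) (10 * n - 1) 0 / 2 - 4 * n

theorem rankValue_eq_rank (hn : 0 < n) {x : Var n → K}
    (h₁ : ∀ k ≤ 4 * n + B.rank, netHankel f B x 1 k ≠ 0)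
    (h₂ : ∀ k ≤ 4 * n + B.rank, netHankel f B x 2 k ≠ 0) : rankValue f B x = B.rank := by
  set L := 4 * n + B.rank with hL
  have hLn : L ≤ 5 * n := by have := B.rank_le_width; omega
  have hhankel : ∀ t k, (Matrix.of fun i j : Fin k =>
      netSequence f B x (t + (i + j : ℕ))).det = netHankel f B x (1 + t) k := by
    intro t k
    simp only [netHankel, Matrix.hankelDet, netSequence, add_assoc]
  have hne : ∀ i < 2 * L, hankelRow (netSequence f B x) i 0 ≠ 0 := by
    intro i hi
    refine hankelRow_zero_ne_zero _ (fun t ht k hk => ?_) hi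
    rw [hhankel]
    obtain rfl | rfl : t = 0 ∨ t = 1 := by omega
    · exact h₁ k hk
    · exact h₂ k hk
  have heq : hankelRow (netSequence f B x) (2 * L) 0 = 0 := by
    refine hankelRow_zero_eq_zero _ hne ?_
    have h3 := hhankel 0 (L + 1)
    simp only [zero_add] at h3
    rw [h3]
    exact Matrix.hankelDet_eq_zero_of_rank_lt _ _ _ one_ne_zero
      (Nat.lt_succ_of_le (rank_netMatrix_le f B _))
  rw [rankValue, scanValue_eq (Nat.zero_le _) (by omega) hne heq]
  omega

open Finset in
theorem card_rankValue_ne_rank_mul_card_le [DecidableEq K] (hn : 0 < n) (hf : IsConcentrator f)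
    (S : Finset K) :
    #{x ∈ Fintype.piFinset fun _ : Var n => S | rankValue f B x ≠ B.rank} * #S ≤
      240 * n ^ 2 * #S ^ Fintype.card (Var n) := by
  have h1 := card_netHankel_eq_zero_mul_card_le f B hn hf S 1 (by omega)
  have h2 := card_netHankel_eq_zero_mul_card_le f B hn hf S 2 (by omega)
  refine (Nat.mul_le_mul_right _ ((Finset.card_le_card ?_).trans (card_union_le
    {x ∈ Fintype.piFinset fun _ : Var n => S |
      ∃ k ≤ 4 * n + B.rank, netHankel f B x 1 k = 0}
    {x ∈ Fintype.piFinset fun _ : Var n => S |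
      ∃ k ≤ 4 * n + B.rank, netHankel f B x 2 k = 0}))).trans (by linarith)
  intro x hx
  simp only [mem_filter, mem_union] at hx ⊢
  by_contra! hcon
  exact hx.2 (rankValue_eq_rank f B hn (hcon.1 hx.1) (hcon.2 hx.1))

variable {f B} {A : Matrix (Fin n) (Fin n) K} {S : Finset K} {hS : S.Nonempty}
  {box : (Fin n → ℕ) → Prog n (Fin n → ℕ)} {mem₀ : List K} {co cc : ℕ}

/-- The rank algorithm draws `118 n` random elements and then runs deterministically: the sequence
takes `10 n` steps of `226 n + co` operations, and the expansion less than `300 n²` operations. -/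
theorem run_rankProg (hn : 0 < n) (hbox : IsBox A S hS box mem₀ B co cc) :
    ∃ o : (Fin (Fintype.card (Var n)) → K) → Outcome K ℕ,
      (rankProg box f).run A S hS mem₀ = (uniformFun S hS _).map o ∧
      ∀ x, (o x).value = rankValue f B (x ∘ Fintype.equivFin (Var n)) ∧
        (o x).ops ≤ 2679 * n ^ 2 + 10 * n * co ∧ (o x).calls = 10 * n * cc := by
  let rest (a : Fin (Fintype.card (Var n)) → ℕ) : Prog n ℕ := .zero fun z =>
    (krylov box f z (fun e => a (Fintype.equivFin (Var n) (.inl e)))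
      (fun i => a (Fintype.equivFin (Var n) (.inr (.inl i)))) (10 * n - 1 + 1)
      fun i => a (Fintype.equivFin (Var n) (.inr (.inr i)))).bind fun h =>
        (scan (10 * n - 1) 0 h fun i => h i.succ).bind fun k => .ret (k / 2 - 4 * n)
  have hrest : ∀ x : Fin (Fintype.card (Var n)) → K,
      Spec A S hS (rest fun i => mem₀.length + i) (mem₀ ++ List.ofFn x)
        (2561 * n ^ 2 + 10 * n * co) (10 * n * cc)
        fun r _ => r = rankValue f B (x ∘ Fintype.equivFin (Var n)) := by
    intro x
    have hx := holds_append_ofFn mem₀ x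
    have hm := List.prefix_append (mem₀ ++ List.ofFn x) [0]
    refine (Spec.zero (((Spec.krylov hbox ((List.prefix_append _ _).trans hm)
      (holds_append_singleton _ _) (fun e => (hx _).mono hm) (fun i => (hx _).mono hm) _
      fun i => (hx _).mono hm).bind fun h mem₁ hm₁ hh =>
        (Spec.scan (h := netSequence f B (x ∘ Fintype.equivFin (Var n))) hh fun i => ?_).bind
          fun k mem₂ hm₂ hk => Spec.ret ?_))).mono ?_ ?_ fun _ _ _ h => h
    · exact hh i.succ
    · rw [hk, rankValue]
    · obtain ⟨k, rfl⟩ : ∃ k, n = k + 1 := ⟨n - 1, by omega⟩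
      rw [show 10 * (k + 1) - 1 = 10 * k + 9 by omega]
      nlinarith
    · rw [Nat.sub_add_cancel (by omega)]
      ring
  choose o ho using hrest
  refine ⟨fun x => (o x).charge (Fintype.card (Var n)) 0, ?_, fun x => ⟨(ho x).2.2.2.2, ?_, ?_⟩⟩
  · rw [rankProg, run_bind, run_sequence_random, PMF.bind_map, ← PMF.bind_pure_comp]
    congr 1
    funext x
    simp only [Function.comp_apply]
    rw [show (rest fun i => mem₀.length + i).run A S hS (mem₀ ++ List.ofFn x) = _ from (ho x).1,
      PMF.pure_map]
  · have := (ho x).2.2.1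
    simp only [Outcome.charge, Fintype.card_sum, Fintype.card_prod, Fintype.card_fin]
    nlinarith
  · exact (ho x).2.2.2.1

theorem toOuterMeasure_run_rankProg_le (hn : 0 < n) (hf : IsConcentrator f)
    {o : (Fin (Fintype.card (Var n)) → K) → Outcome K ℕ}
    (ho : ∀ x, (o x).value = rankValue f B (x ∘ Fintype.equivFin (Var n))) :
    ((uniformFun S hS _).map o).toOuterMeasure {o | o.value ≠ B.rank} ≤
      (240 * n ^ 2 : ENNReal) / S.card := by
  classical
  rw [PMF.toOuterMeasure_map_apply]
  have hset : o ⁻¹' {o | o.value ≠ B.rank} =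
      {x | rankValue f B (x ∘ Fintype.equivFin (Var n)) ≠ B.rank} := by
    ext x
    simp [ho x]
  have hcard : (Finset.filter (fun x => rankValue f B (x ∘ Fintype.equivFin (Var n)) ≠ B.rank)
      (Fintype.piFinset fun _ => S)).card ≤
      (Finset.filter (fun x => rankValue f B x ≠ B.rank)
        (Fintype.piFinset fun _ : Var n => S)).card := by
    refine Finset.card_le_card_of_injOn (fun x => x ∘ Fintype.equivFin (Var n)) ?_ ?_
    · intro x hx
      simp only [Finset.coe_filter, Set.mem_ofPred_eq, Fintype.mem_piFinset] at hx ⊢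
      exact ⟨fun i => hx.1 _, hx.2⟩
    · intro x _ y _ hxy
      exact (Fintype.equivFin (Var n)).surjective.injective_comp_right hxy
  have hcount := (Nat.mul_le_mul_right S.card hcard).trans
    (card_rankValue_ne_rank_mul_card_le f B hn hf S)
  have hS0 : (S.card : ENNReal) ≠ 0 := by exact_mod_cast hS.card_pos.ne'
  rw [hset, toOuterMeasure_uniformFun]
  refine ENNReal.div_le_of_le_mul ?_
  rw [← ENNReal.mul_div_right_comm, ENNReal.le_div_iff_mul_le (.inl hS0)
    (.inl (ENNReal.natCast_ne_top _))]
  exact_mod_cast hcount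

end rankProg

end BlackBox

/-! ### The Nullity algorithm -/

namespace BlackBox

theorem Prog.bind_ret {n : ℕ} {α : Type} (p : Prog n α) : p.bind .ret = p := by
  induction p with
  | ret a => rfl
  | zero k ih | one k ih | arith o a b k ih | isZero a k ih | random k ih | blackBox v k ih =>
    simp only [bind, ih]

/-- The black-box rank algorithm, for the matrix in the black box. -/
noncomputable def rankAlgorithm (n : ℕ) : Prog n ℕ :=
  rankProg (fun v => .blackBox v .ret) (exists_isConcentrator n).choose

theorem rankStep_rankAlgorithm (n d e : ℕ) :
    rankStep rankAlgorithm n d e =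
      rankProg (powerBox n d e) (exists_isConcentrator n).choose := by
  simp only [rankStep, rankAlgorithm, withBlackBox_rankProg, Prog.withBlackBox, Prog.bind_ret]

section nullity

open Polynomial

variable {K : Type*} [Field K] {n : ℕ} (A : Matrix (Fin n) (Fin n) K) (P : K[X])
  {S : Finset K} (hS : S.Nonempty)

theorem isBox_powerBox (e : ℕ) :
    IsBox A S hS (powerBox n P.natDegree e) (coeffs P) (aeval A P ^ e)
      (e * (n + P.natDegree * (2 * n))) (e * P.natDegree) :=
  fun _ hmem _ _ hv => Spec.powerBox hmem hv

theorem run_nullity {rankAlg : (n : ℕ) → Prog n ℕ} {d e : ℕ} {mem : List K} :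
    (nullity rankAlg n d e).run A S hS mem = ((rankStep rankAlg n d e).run A S hS mem).map
      fun o => { o with value := (n - o.value) / d } := by
  rw [nullity, run_bind, ← PMF.bind_pure_comp]
  congr 1
  funext o
  simp [Prog.run, PMF.pure_map, Outcome.charge]

end nullity

end BlackBox

theorem mainTheorem5 :
    ∃ (rankAlg : (n : ℕ) → BlackBox.Prog n ℕ) (C : ℕ),
      ∀ (K : Type*) [Field K] (n : ℕ) (A : Matrix (Fin n) (Fin n) K) (P : Polynomial K)
        (d e m : ℕ) (Ω : ℕ) (S : Finset K) (hS : S.Nonempty),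
        Irreducible P → P ∣ minpoly K A →
        d = P.natDegree → e = multiplicity P (minpoly K A) → m = multiplicity P A.charpoly →
        n ≤ Ω →
        -- the number that the algorithm is meant to return is the multiplicity
        ((n : ℚ) - ((Polynomial.aeval A P ^ e).rank : ℚ)) / (d : ℚ) = (m : ℚ) ∧
        -- Horner's rule applies `P(A)ᵉ` to a vector, with `e d` products and cost `O(e d Ω)`
        (∀ (mem : List K) (v : Fin n → ℕ),
          (∀ i, v i < (BlackBox.coeffs P ++ mem).length) →
          ∀ o ∈ ((BlackBox.powerBox n d e v).run A S hS (BlackBox.coeffs P ++ mem)).support,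
            (fun i => BlackBox.read o.mem (o.value i)) =
              (Polynomial.aeval A P ^ e).mulVec
                (fun i => BlackBox.read (BlackBox.coeffs P ++ mem) (v i)) ∧
            o.calls = e * d ∧ o.cost Ω ≤ C * (e * d * Ω)) ∧
        -- the rank step finds the rank of `P(A)ᵉ`
        (((BlackBox.rankStep rankAlg n d e).run A S hS (BlackBox.coeffs P)).toOuterMeasure
            {o | o.value ≠ (Polynomial.aeval A P ^ e).rank} ≤
          (C * n ^ 2 : ENNReal) / S.card) ∧
        -- the algorithm returns the multiplicity
        (((BlackBox.nullity rankAlg n d e).run A S hS (BlackBox.coeffs P)).toOuterMeasure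
            {o | o.value ≠ m} ≤
          (C * n ^ 2 : ENNReal) / S.card) ∧
        -- the cost, whatever the random choices
        (∀ o ∈ ((BlackBox.nullity rankAlg n d e).run A S hS (BlackBox.coeffs P)).support,
          o.cost Ω ≤ C * (e * d * n * Ω)) := by
  refine ⟨BlackBox.rankAlgorithm, 3000, ?_⟩
  rintro K _ n A P d e m Ω S hS hP hdvd rfl rfl rfl hΩ
  have hn : 0 < n := by
    rw [Nat.pos_iff_ne_zero]
    rintro rfl
    have h := hdvd.trans (Matrix.minpoly_dvd_charpoly A)
    rw [Matrix.charpoly, Matrix.det_isEmpty] at h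
    exact hP.not_isUnit (isUnit_of_dvd_one h)
  have hd : 0 < P.natDegree := hP.natDegree_pos
  have he : 0 < multiplicity P (minpoly K A) :=
    Nat.pos_of_ne_zero fun h => multiplicity_eq_zero.mp h hdvd
  have hrank := Matrix.rank_aeval_pow_multiplicity A hP
  rw [Fintype.card_fin] at hrank
  generalize multiplicity P (minpoly K A) = e at *
  generalize multiplicity P A.charpoly = m at *
  have hf := (BlackBox.exists_isConcentrator n).choose_spec
  have hbox := BlackBox.isBox_powerBox A P hS e
  obtain ⟨o, hrun, ho⟩ := BlackBox.run_rankProg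
    (f := (BlackBox.exists_isConcentrator n).choose) hn hbox
  rw [← BlackBox.rankStep_rankAlgorithm] at hrun
  have herr : ((BlackBox.rankStep BlackBox.rankAlgorithm n P.natDegree e).run A S hS
      (BlackBox.coeffs P)).toOuterMeasure {o | o.value ≠ (Polynomial.aeval A P ^ e).rank} ≤
        ((3000 : ℕ) * n ^ 2 : ENNReal) / S.card := by
    rw [hrun]
    refine (BlackBox.toOuterMeasure_run_rankProg_le hn hf fun x => (ho x).1).trans ?_
    gcongr
    norm_num
  have hed : 1 ≤ e * P.natDegree := Nat.mul_pos he hd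
  refine ⟨?_, ?_, herr, ?_, ?_⟩
  · rw [div_eq_iff (by exact_mod_cast hd.ne'), sub_eq_iff_eq_add', mul_comm (m : ℚ)]
    exact_mod_cast hrank.symm
  · intro mem v hv o' ho'
    obtain ⟨o'', h1, -, h2, h3, h4⟩ := hbox _ (List.prefix_append _ mem) v _ fun i => ⟨hv i, rfl⟩
    rw [h1, PMF.mem_support_pure_iff] at ho'
    subst ho'
    refine ⟨funext fun i => (h4 i).2, h3, ?_⟩
    rw [BlackBox.Outcome.cost, h3]
    have h5 : e * n ≤ e * P.natDegree * Ω := Nat.mul_le_mul (Nat.le_mul_of_pos_right _ hd) hΩ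
    have h6 : e * P.natDegree * n ≤ e * P.natDegree * Ω := Nat.mul_le_mul_left _ hΩ
    linarith
  · rw [BlackBox.run_nullity, PMF.toOuterMeasure_map_apply]
    refine (MeasureTheory.measure_mono ?_).trans herr
    intro o' ho' hr
    refine ho' ?_
    change (n - o'.value) / _ = _
    rw [hr, Nat.sub_eq_of_eq_add' hrank.symm, Nat.mul_div_cancel_left _ hd]
  · intro o' ho'
    rw [BlackBox.run_nullity, hrun, PMF.map_comp, PMF.mem_support_map_iff] at ho'
    obtain ⟨x, -, rfl⟩ := ho'
    obtain ⟨-, h1, h2⟩ := ho x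
    change (o x).ops + (o x).calls * Ω ≤ _
    rw [h2]
    have h3 : n ^ 2 ≤ e * P.natDegree * n * Ω := by
      calc n ^ 2 = 1 * n * n := by ring
        _ ≤ _ := by gcongr
    have h4 : e * n * n ≤ e * P.natDegree * n * Ω := by
      gcongr
      exact Nat.le_mul_of_pos_right _ hd
    have h5 : e * P.natDegree * n * n ≤ e * P.natDegree * n * Ω := by gcongr
    linarith
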